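/- Let $G$ be a finite simple graph with no induced subgraph isomorphic to $2K_2$ (the disjoint union of two edges). Let $\Delta$, $\omega$, $\chi$ denote its maximum degree, clique number and chromatic number. Then at least one of the following holds. (0) $\chi \le \max\{\omega, \Delta-1\}$. (1) $\Delta \le 3$, $\omega = 2$, $\chi = 3$, and $G$ contains an induced cycle of odd length. (2) $\Delta = 4 = \chi$, $\omega = 3$, and the graph obtained from $G$ by deleting its isolated vertices (this is $G$ itself if $G$ is connected) is isomorphic to one of the following four graphs: - $A$: vertices $0,\dots,6$ and edges $45,46,56,14,15,24,26,35,36,01,02,03$; - $B$: the graph $A$ with the additional edge $23$; - $C$: the complement of the cycle $C_7$; - $D$: the graph $A$ with an additional vertex $7$ and the additional edges $71,72,73$. -/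

import Mathlib

open scoped SimpleGraph

/-- `2K₂`, the disjoint union of two edges. -/
abbrev twoK2 : SimpleGraph (Fin 2 ⊕ Fin 2) :=
  (⊤ : SimpleGraph (Fin 2)) ⊕g (⊤ : SimpleGraph (Fin 2))

/-- `G` has no induced subgraph isomorphic to `2K₂`. -/
def TwoK2Free {V : Type*} (G : SimpleGraph V) : Prop :=
  ¬ twoK2.IsIndContained G

/-- `G` has an induced cycle of odd length. -/
def HasInducedOddCycle {V : Type*} (G : SimpleGraph V) : Prop :=
  ∃ n : ℕ, 3 ≤ n ∧ Odd n ∧ (SimpleGraph.cycleGraph n).IsIndContained G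

/-- The triangle `4,5,6`, vertices `1,2,3` each joined to a different pair of its vertices,
and a vertex `0` joined to `1,2,3`: 7 vertices, 12 edges. -/
def exceptionA : SimpleGraph (Fin 7) :=
  SimpleGraph.fromEdgeSet
    {s(4, 5), s(4, 6), s(5, 6), s(1, 4), s(1, 5), s(2, 4), s(2, 6), s(3, 5), s(3, 6),
      s(0, 1), s(0, 2), s(0, 3)}

/-- `exceptionA` with the additional edge `23`: 7 vertices, 13 edges. -/
def exceptionB : SimpleGraph (Fin 7) :=
  SimpleGraph.fromEdgeSet
    {s(4, 5), s(4, 6), s(5, 6), s(1, 4), s(1, 5), s(2, 4), s(2, 6), s(3, 5), s(3, 6),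
      s(0, 1), s(0, 2), s(0, 3), s(2, 3)}

/-- The complement of the 7-cycle: 7 vertices, 14 edges. -/
def exceptionC : SimpleGraph (Fin 7) :=
  (SimpleGraph.cycleGraph 7)ᶜ

/-- `exceptionA` with a second vertex `7` joined to `1,2,3`: 8 vertices, 15 edges. -/
def exceptionD : SimpleGraph (Fin 8) :=
  SimpleGraph.fromEdgeSet
    {s(4, 5), s(4, 6), s(5, 6), s(1, 4), s(1, 5), s(2, 4), s(2, 6), s(3, 5), s(3, 6),
      s(0, 1), s(0, 2), s(0, 3), s(7, 1), s(7, 2), s(7, 3)}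

/-- `G` is isomorphic to one of the exceptional graphs. -/
def IsExceptional {V : Type*} (G : SimpleGraph V) : Prop :=
  Nonempty (G ≃g exceptionA) ∨ Nonempty (G ≃g exceptionB) ∨
    Nonempty (G ≃g exceptionC) ∨ Nonempty (G ≃g exceptionD)

/-! Write M = max{ω, Δ − 1} and suppose that χ > M. Two facts carry the proof.

(1) If q ≥ 4, Δ ≤ q + 1 and ω ≤ q, then χ ≤ q (`TwoK2Free.colorable_of_degreeAtMost_succ`). Hence M
≤ 3, so Δ ≤ 4 and ω ≤ 3.

(2) If Δ ≤ 4 and ω ≤ 3, then χ ≤ 3 or the non-isolated vertices span one of the four exceptional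
graphs (`TwoK2Free.colorable_three_or_isExceptional`). If χ ≤ 3, then M ≤ 2, and a triangle-free
2K₂-free graph that is not bipartite contains an induced C₅ (`TwoK2Free.colorable_two`).

Fact (1) is an induction on q. Deleting a maximal independent set I lowers the degree bound, and it
lowers the clique bound too if I meets all q-cliques; one more colour serves I. Two disjoint
q-cliques allow a direct q-colouring by Hall's theorem (`TwoK2Free.colorable_of_disjoint_cliques`).
Otherwise the degree bound forces a vertex common to all q-cliques
(`exists_mem_of_intersecting_cliques`), and I is chosen to contain it. For q = 4, fact (2) applies
to G − I. If G − I is exceptional, a vertex of degree 4 in it has exactly one neighbour in I, and a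
finite check of the possible neighbourhoods of such vertices of I yields a 4-colouring
(`TwoK2Free.colorable_four_of_isExceptional`).

Fact (2) is an exhaustive computation. All edges of a 2K₂-free graph lie in one component; the
search grows this component from a triangle, one vertex at a time, and the kernel evaluates it. -/

/-! ### Basic facts on `2K₂`-free graphs and degree bounds -/

section Basics

variable {V : Type*} {G : SimpleGraph V}

theorem TwoK2Free.adj_cross (hG : TwoK2Free G) {a b c d : V} (hab : G.Adj a b)
    (hcd : G.Adj c d) : G.Adj a c ∨ G.Adj a d ∨ G.Adj b c ∨ G.Adj b d := by
  by_contra! h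
  obtain ⟨hac, had, hbc, hbd⟩ := h
  have nac : a ≠ c := by rintro rfl; exact had hcd
  have nad : a ≠ d := by rintro rfl; exact hac hcd.symm
  have nbc : b ≠ c := by rintro rfl; exact hbd hcd
  have nbd : b ≠ d := by rintro rfl; exact hbc hcd.symm
  have nab := hab.ne
  have ncd := hcd.ne
  refine hG ⟨⟨⟨Sum.elim ![a, b] ![c, d], ?_⟩, ?_⟩⟩
  · rintro (i | i) (j | j) h <;> fin_cases i <;> fin_cases j <;> simp_all
  · change ∀ {i j}, G.Adj (Sum.elim ![a, b] ![c, d] i) (Sum.elim ![a, b] ![c, d] j) ↔ _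
    rintro (i | i) (j | j) <;> fin_cases i <;> fin_cases j <;>
      simp_all [SimpleGraph.adj_comm]

theorem TwoK2Free.induce (hG : TwoK2Free G) (s : Set V) : TwoK2Free (G.induce s) :=
  fun h => hG (h.trans ⟨SimpleGraph.Embedding.induce s⟩)

/-- Every vertex has at most `k` neighbours. -/
def DegreeAtMost (G : SimpleGraph V) (k : ℕ) : Prop :=
  ∀ (v : V) (T : Finset V), (∀ t ∈ T, G.Adj v t) → T.card ≤ k

theorem DegreeAtMost.mono {k l : ℕ} (h : DegreeAtMost G k) (hkl : k ≤ l) : DegreeAtMost G l :=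
  fun v T hT => (h v T hT).trans hkl

theorem degreeAtMost_maxDegree [Fintype V] [DecidableRel G.Adj] :
    DegreeAtMost G G.maxDegree := by
  intro v T hT
  refine le_trans ?_ (G.degree_le_maxDegree v)
  rw [← SimpleGraph.card_neighborFinset_eq_degree]
  exact Finset.card_le_card fun t ht => by simpa using hT t ht

/-- Deleting a maximal independent set lowers the degree bound. -/
theorem DegreeAtMost.induce_compl {k : ℕ} (h : DegreeAtMost G (k + 1)) {I : Set V}
    (hI : ∀ v ∉ I, ∃ y ∈ I, G.Adj v y) : DegreeAtMost (G.induce Iᶜ) k := by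
  classical
  rintro ⟨v, hv⟩ T hT
  obtain ⟨y, hy, hvy⟩ := hI v hv
  have hyT : y ∉ T.map (Function.Embedding.subtype _) := by
    simp only [Finset.mem_map, not_exists, not_and]
    rintro ⟨t, ht⟩ - rfl
    exact ht hy
  have := h v (insert y (T.map (Function.Embedding.subtype _))) (by
    intro t ht
    rcases Finset.mem_insert.1 ht with rfl | ht
    · exact hvy
    · obtain ⟨t, ht', rfl⟩ := Finset.mem_map.1 ht
      exact hT t ht')
  rw [Finset.card_insert_of_notMem hyT, Finset.card_map] at this
  omega

/-- Every independent set extends to a maximal one. -/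
theorem exists_maximal_independent [Finite V] (J : Set V) (hJ : ∀ a ∈ J, ∀ b ∈ J, ¬ G.Adj a b) :
    ∃ I : Set V, J ⊆ I ∧ (∀ a ∈ I, ∀ b ∈ I, ¬ G.Adj a b) ∧ ∀ v ∉ I, ∃ y ∈ I, G.Adj v y := by
  obtain ⟨I, hJI, hI⟩ :=
    (Set.toFinite {I : Set V | ∀ a ∈ I, ∀ b ∈ I, ¬ G.Adj a b}).exists_le_maximal hJ
  refine ⟨I, hJI, hI.prop, fun v hv => ?_⟩
  by_contra! hy
  have : insert v I ∈ {I : Set V | ∀ a ∈ I, ∀ b ∈ I, ¬ G.Adj a b} := by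
    rintro a (rfl | ha) b (rfl | hb)
    · exact G.irrefl
    · exact hy b hb
    · exact fun h => hy a ha h.symm
    · exact hI.prop a ha b hb
  exact hv (hI.le_of_ge this (Set.subset_insert v I) (Set.mem_insert v I))

/-- An independent set costs at most one more colour. -/
theorem colorable_succ_of_induce_compl {k : ℕ} {I : Set V} (hI : ∀ a ∈ I, ∀ b ∈ I, ¬ G.Adj a b)
    (h : (G.induce Iᶜ).Colorable k) : G.Colorable (k + 1) := by
  classical
  obtain ⟨c⟩ := h
  refine ⟨SimpleGraph.Coloring.mk
    (fun v => if hv : v ∈ I then Fin.last k else (c ⟨v, hv⟩).castSucc) ?_⟩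
  intro v w hvw
  by_cases hv : v ∈ I <;> by_cases hw : w ∈ I
  · exact absurd hvw (hI v hv w hw)
  · simp [hv, hw, (Fin.castSucc_lt_last _).ne']
  · simp [hv, hw, (Fin.castSucc_lt_last _).ne]
  · simpa [hv, hw] using c.valid (v := ⟨v, hv⟩) (w := ⟨w, hw⟩) hvw

/-! ### Colouring triangle-free 2K₂-free graphs. -/

theorem not_triangle (h : G.CliqueFree 3) {a b c : V} (hab : G.Adj a b) (hac : G.Adj a c) :
    ¬ G.Adj b c := by
  classical
  exact fun hbc => h {a, b, c} (SimpleGraph.is3Clique_triple_iff.2 ⟨hab, hac, hbc⟩)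

/-- For an edge uv, the neighbourhoods of u and of v are independent because there is no triangle,
and the vertices adjacent to neither are independent because there is no 2K₂. -/
theorem TwoK2Free.colorable_three_of_cliqueFree_three (hG : TwoK2Free G) (h3 : G.CliqueFree 3) :
    G.Colorable 3 := by
  classical
  by_cases he : ∃ u v, G.Adj u v
  · obtain ⟨u, v, huv⟩ := he
    refine ⟨SimpleGraph.Coloring.mk
      (fun x => if G.Adj u x then (0 : Fin 3) else if G.Adj v x then 1 else 2) ?_⟩
    intro x y hxy
    have h1 := fun (hx : G.Adj u x) hy => not_triangle h3 hx hy hxy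
    have h2 := fun (hx : G.Adj v x) hy => not_triangle h3 hx hy hxy
    have h4 := hG.adj_cross huv hxy
    split_ifs <;> simp_all
  · push Not at he
    exact ⟨SimpleGraph.Coloring.mk (fun _ => 0) fun h => absurd h (he _ _)⟩

/-- The three classes of the previous colouring reduce to two: a vertex w adjacent to neither end of
uv cannot have neighbours both in N(u) and in N(v), since these would close an induced C₅. So w
joins the class of N(u) if it has a neighbour in N(v), and the class of N(v) otherwise. -/
theorem TwoK2Free.colorable_two (hG : TwoK2Free G) (h3 : G.CliqueFree 3)
    (h5 : ¬ (SimpleGraph.cycleGraph 5).IsIndContained G) : G.Colorable 2 := by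
  classical
  by_cases he : ∃ u v, G.Adj u v
  · obtain ⟨u, v, huv⟩ := he
    have hc : ∀ a w b, G.Adj u a → G.Adj v b → G.Adj w a → G.Adj w b → ¬ G.Adj u w →
        ¬ G.Adj v w → False := by
      intro a w b hua hvb hwa hwb huw hvw
      have hab := not_triangle h3 hwa hwb
      have hva := not_triangle h3 huv hua
      have hub := not_triangle h3 huv.symm hvb
      have e1 := huv.ne
      have e2 := hua.ne
      have e3 := hvb.ne
      have e4 := hwa.ne
      have e5 := hwb.ne
      have e6 : u ≠ w := by rintro rfl; exact hvw huv.symm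
      have e7 : v ≠ w := by rintro rfl; exact huw huv
      have e8 : a ≠ b := by rintro rfl; exact hva hvb
      have e9 : u ≠ b := by rintro rfl; exact huw hwb.symm
      have e10 : v ≠ a := by rintro rfl; exact hvw hwa.symm
      refine h5 ⟨⟨⟨![u, a, w, b, v], ?_⟩, ?_⟩⟩
      · intro i j h
        fin_cases i <;> fin_cases j <;> simp_all
      · intro i j
        have : (SimpleGraph.cycleGraph 5).Adj i j ↔ (i - j = 1 ∨ j - i = 1) :=
          SimpleGraph.cycleGraph_adj
        rw [this]
        change G.Adj (![u, a, w, b, v] i) (![u, a, w, b, v] j) ↔ _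
        fin_cases i <;> fin_cases j <;>
          first
          | refine iff_of_true ?_ (by decide)
            simp_all [SimpleGraph.adj_comm]
          | refine iff_of_false ?_ (by decide)
            simp_all [SimpleGraph.adj_comm]
    refine ⟨SimpleGraph.Coloring.mk
      (fun x => if G.Adj u x ∨ (¬ G.Adj v x ∧ ∃ b, G.Adj v b ∧ G.Adj x b)
        then (0 : Fin 2) else 1) ?_⟩
    intro x y hxy
    have h2 := fun (hx : G.Adj v x) hy => not_triangle h3 hx hy hxy
    have h4 := hG.adj_cross huv hxy
    have key : ∀ x y, G.Adj x y → (G.Adj u x ∨ (¬ G.Adj v x ∧ ∃ b, G.Adj v b ∧ G.Adj x b)) →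
        (G.Adj u y ∨ (¬ G.Adj v y ∧ ∃ b, G.Adj v b ∧ G.Adj y b)) → False := by
      rintro x y hxy (hx | ⟨hx, b, hb, hxb⟩) (hy | ⟨hy, b', hb', hyb'⟩)
      · exact not_triangle h3 hx hy hxy
      · by_cases huy : G.Adj u y
        · exact not_triangle h3 hx huy hxy
        · exact hc x y b' hx hb' hxy.symm hyb' huy hy
      · by_cases hux : G.Adj u x
        · exact not_triangle h3 hux hy hxy
        · exact hc y x b hy hb hxy hxb hux hx
      · by_cases hux : G.Adj u x
        · by_cases huy : G.Adj u y
          · exact not_triangle h3 hux huy hxy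
          · exact hc x y b' hux hb' hxy.symm hyb' huy hy
        · by_cases huy : G.Adj u y
          · exact hc y x b huy hb hxy hxb hux hx
          · rcases hG.adj_cross huv hxy with h | h | h | h <;> contradiction
    by_cases hx : G.Adj u x ∨ (¬ G.Adj v x ∧ ∃ b, G.Adj v b ∧ G.Adj x b) <;>
      by_cases hy : G.Adj u y ∨ (¬ G.Adj v y ∧ ∃ b, G.Adj v b ∧ G.Adj y b)
    · exact absurd hy (fun hy => key x y hxy hx hy)
    · rw [if_pos hx, if_neg hy]; decide
    · rw [if_neg hx, if_pos hy]; decide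
    · exfalso
      push Not at hx hy
      by_cases hvx : G.Adj v x
      · by_cases hvy : G.Adj v y
        · exact h2 hvx hvy
        · exact hy.2 hvy x hvx hxy.symm
      · by_cases hvy : G.Adj v y
        · exact hx.2 hvx y hvy hxy
        · rcases h4 with h | h | h | h
          · exact hx.1 h
          · exact hy.1 h
          · exact hvx h
          · exact hvy h
  · push Not at he
    exact ⟨SimpleGraph.Coloring.mk (fun _ => 0) fun h => absurd h (he _ _)⟩

end Basics

/-! ### Bitmasks -/

/-- The `j`-th binary digit of `S`. -/
def hasBit (S j : ℕ) : Bool := Nat.beq (Nat.land 1 (Nat.shiftRight S j)) 1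

theorem hasBit_eq_testBit (S j : ℕ) : hasBit S j = S.testBit j := by
  have h : hasBit S j = Nat.beq (1 &&& (S >>> j)) 1 := rfl
  rw [h, Nat.testBit, Nat.one_and_eq_mod_two]
  rcases Nat.mod_two_eq_zero_or_one (S >>> j) with h | h <;> rw [h] <;> rfl

theorem hasBit_land (a b j : ℕ) : hasBit (Nat.land a b) j = (hasBit a j && hasBit b j) := by
  simp only [hasBit_eq_testBit]
  exact Nat.testBit_and a b j

theorem hasBit_lor (a b j : ℕ) : hasBit (Nat.lor a b) j = (hasBit a j || hasBit b j) := by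
  simp only [hasBit_eq_testBit]
  exact Nat.testBit_or a b j

theorem hasBit_pow (i j : ℕ) : hasBit (Nat.pow 2 i) j = decide (i = j) := by
  rw [hasBit_eq_testBit]
  exact Nat.testBit_two_pow

theorem eq_of_hasBit_eq {a b : ℕ} (h : ∀ j, hasBit a j = hasBit b j) : a = b :=
  Nat.eq_of_testBit_eq fun j => by simpa only [hasBit_eq_testBit] using h j

theorem hasBit_zero (j : ℕ) : hasBit 0 j = false := by simp [hasBit_eq_testBit]

theorem land_eq_zero_iff {a b : ℕ} :
    Nat.land a b = 0 ↔ ∀ j, hasBit a j = true → hasBit b j = false := by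
  constructor
  · intro h j ha
    have := hasBit_land a b j
    rw [h, hasBit_zero, ha, Bool.true_and] at this
    exact this.symm
  · intro h
    refine eq_of_hasBit_eq fun j => ?_
    rw [hasBit_land, hasBit_zero]
    cases ha : hasBit a j
    · rfl
    · simp [h j ha]

theorem land_eq_left_iff {a b : ℕ} :
    Nat.land a b = a ↔ ∀ j, hasBit a j = true → hasBit b j = true := by
  constructor
  · intro h j ha
    have := hasBit_land a b j
    rw [h, ha, Bool.true_and] at this
    exact this.symm
  · intro h
    refine eq_of_hasBit_eq fun j => ?_
    rw [hasBit_land]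
    cases ha : hasBit a j
    · rfl
    · simp [h j ha]

/-- The number of binary digits `1` of `S` below position `n`. -/
def bitCount (S : ℕ) : ℕ → ℕ
  | 0 => 0
  | n + 1 => bif hasBit S n then Nat.succ (bitCount S n) else bitCount S n

theorem bitCount_eq_card (S n : ℕ) :
    bitCount S n = ((Finset.range n).filter fun j => hasBit S j = true).card := by
  induction n with
  | zero => rfl
  | succ n ih =>
    rw [Finset.range_add_one, Finset.filter_insert, bitCount]
    cases h : hasBit S n <;> simp [ih]

/-- Every predicate on the numbers below `n` is given by a mask. -/
theorem exists_mask (p : ℕ → Prop) (n : ℕ) : ∃ S, ∀ j, hasBit S j = true ↔ j < n ∧ p j := by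
  classical
  induction n with
  | zero => exact ⟨0, fun j => by simp [hasBit_zero]⟩
  | succ n ih =>
    obtain ⟨S, hS⟩ := ih
    refine ⟨if p n then Nat.lor S (Nat.pow 2 n) else S, fun j => ?_⟩
    split_ifs with h
    · rw [hasBit_lor, hasBit_pow, Bool.or_eq_true, hS, decide_eq_true_iff]
      constructor
      · rintro (⟨h1, h2⟩ | rfl)
        · exact ⟨by omega, h2⟩
        · exact ⟨by omega, h⟩
      · rintro ⟨h1, h2⟩
        by_cases hj : n = j
        · exact .inr hj
        · exact .inl ⟨by omega, h2⟩
    · rw [hS]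
      constructor
      · rintro ⟨h1, h2⟩
        exact ⟨by omega, h2⟩
      · rintro ⟨h1, h2⟩
        refine ⟨?_, h2⟩
        rcases Nat.lt_succ_iff_lt_or_eq.1 h1 with h1 | rfl
        · exact h1
        · exact absurd h2 h

/-- `chk` holds for all masks obtained from `acc` by adding at most `b` of the digits in the
list. -/
def forallMasks (chk : ℕ → Bool) : List ℕ → ℕ → ℕ → Bool
  | [], _, acc => chk acc
  | j :: l, b, acc =>
    forallMasks chk l b acc &&
      match b with
      | 0 => true
      | b + 1 => forallMasks chk l b (Nat.lor acc (Nat.pow 2 j))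

/-- The budget `b` counts only the digits taken from the list; those of `acc` are free. -/
theorem forallMasks_spec {chk : ℕ → Bool} {l : List ℕ} {b acc : ℕ} (hl : l.Nodup)
    (h : forallMasks chk l b acc = true) {S : ℕ}
    (hacc : ∀ j, hasBit acc j = true → hasBit S j = true)
    (hS : ∀ j, hasBit S j = true → hasBit acc j = true ∨ j ∈ l)
    (hb : (l.filter fun j => hasBit S j).length ≤ b) : chk S = true := by
  induction l generalizing b acc with
  | nil =>
    have : S = acc := eq_of_hasBit_eq fun j => by
      rw [Bool.eq_iff_iff]
      exact ⟨fun hj => (hS j hj).elim id (by simp), hacc j⟩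
    rw [this]
    exact h
  | cons j l ih =>
    unfold forallMasks at h
    rw [Bool.and_eq_true] at h
    rw [List.nodup_cons] at hl
    by_cases hj : hasBit S j = true
    · rw [List.filter_cons_of_pos (by simpa using hj), List.length_cons] at hb
      obtain ⟨b, rfl⟩ : ∃ b', b = b' + 1 := ⟨b - 1, by omega⟩
      refine ih hl.2 h.2 (fun i hi => ?_) (fun i hi => ?_) (by omega)
      · rw [hasBit_lor, hasBit_pow, Bool.or_eq_true, decide_eq_true_iff] at hi
        rcases hi with hi | rfl
        · exact hacc i hi
        · exact hj
      · rw [hasBit_lor, hasBit_pow, Bool.or_eq_true, decide_eq_true_iff]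
        rcases hS i hi with hi | hi
        · exact .inl (.inl hi)
        · rcases List.mem_cons.1 hi with rfl | hi
          · exact .inl (.inr rfl)
          · exact .inr hi
    · rw [List.filter_cons_of_neg (by simpa using hj)] at hb
      refine ih hl.2 h.1 hacc (fun i hi => ?_) hb
      rcases hS i hi with hi' | hi'
      · exact .inl hi'
      · rcases List.mem_cons.1 hi' with rfl | hi'
        · exact absurd hi hj
        · exact .inr hi'

/-! ### Graphs given by lists of bitmasks -/

/-- The `i`-th row of an adjacency matrix. -/
def row (A : List ℕ) (i : ℕ) : ℕ := A.getD i 0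

/-- Append a vertex with neighbourhood `S` to an adjacency matrix; `N` is the mask of the new
vertex and `i` the index of the first row. -/
def addVertex (N S : ℕ) : List ℕ → ℕ → List ℕ
  | [], _ => [S]
  | a :: A, i => (bif hasBit S i then Nat.lor a N else a) :: addVertex N S A (Nat.succ i)

theorem addVertex_length (N S : ℕ) (A : List ℕ) (i : ℕ) :
    (addVertex N S A i).length = A.length + 1 := by
  induction A generalizing i with
  | nil => rfl
  | cons a A ih => simp [addVertex, ih]

theorem row_addVertex_of_lt (N S : ℕ) (A : List ℕ) (i j : ℕ) (hj : j < A.length) :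
    row (addVertex N S A i) j =
      bif hasBit S (i + j) then Nat.lor (row A j) N else row A j := by
  induction A generalizing i j with
  | nil => simp at hj
  | cons a A ih =>
    cases j with
    | zero => simp [addVertex, row]
    | succ j =>
      have := ih (i + 1) j (by simpa using hj)
      simp only [row, addVertex, List.getD_cons_succ] at this ⊢
      rw [this, show i + 1 + j = i + (j + 1) by omega]

theorem row_addVertex_length (N S : ℕ) (A : List ℕ) (i : ℕ) :
    row (addVertex N S A i) A.length = S := by
  induction A generalizing i with
  | nil => rfl
  | cons a A ih => simpa [row, addVertex] using ih (i + 1)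

/-- An edge of a graph: the mask of its ends, and the union and the intersection of their
neighbourhoods. -/
structure EdgeData where
  ends : ℕ
  union : ℕ
  inter : ℕ

/-- Prepend the edges that join a vertex with row `a` and mask `p` to the vertices whose rows are
listed. -/
def rowEdges (a p : ℕ) (rest : List EdgeData) : List ℕ → ℕ → List EdgeData
  | [], _ => rest
  | b :: B, j =>
    bif hasBit a j then
      ⟨Nat.lor p (Nat.pow 2 j), Nat.lor a b, Nat.land a b⟩ :: rowEdges a p rest B (Nat.succ j)
    else rowEdges a p rest B (Nat.succ j)

/-- The edges of a graph given by its adjacency matrix. -/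
def edges : List ℕ → ℕ → List EdgeData
  | [], _ => []
  | a :: A, i => rowEdges a (Nat.pow 2 i) (edges A (Nat.succ i)) A (Nat.succ i)

theorem mem_rowEdges {a p : ℕ} {rest : List EdgeData} {B : List ℕ} {j : ℕ} {d : EdgeData}
    (h : d ∈ rowEdges a p rest B j) :
    d ∈ rest ∨ ∃ q < B.length, hasBit a (j + q) = true ∧
      d = ⟨Nat.lor p (Nat.pow 2 (j + q)), Nat.lor a (row B q), Nat.land a (row B q)⟩ := by
  induction B generalizing j with
  | nil => exact .inl h
  | cons b B ih =>
    have step : d ∈ rowEdges a p rest B (j + 1) → d ∈ rest ∨ ∃ q < (b :: B).length,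
        hasBit a (j + q) = true ∧ d = ⟨Nat.lor p (Nat.pow 2 (j + q)),
          Nat.lor a (row (b :: B) q), Nat.land a (row (b :: B) q)⟩ := by
      intro h
      rcases ih h with h | ⟨q, hq, h1, h2⟩
      · exact .inl h
      · refine .inr ⟨q + 1, by simpa using hq, ?_, ?_⟩
        · rwa [show j + (q + 1) = j + 1 + q by omega]
        · rw [h2, show j + (q + 1) = j + 1 + q by omega]
          simp [row]
    rw [rowEdges] at h
    cases hj : hasBit a j
    · rw [hj] at h
      exact step h
    · rw [hj, cond_true, List.mem_cons] at h
      rcases h with rfl | h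
      · exact .inr ⟨0, by simp, hj, rfl⟩
      · exact step h

theorem mem_edges {A : List ℕ} {i : ℕ} {d : EdgeData} (h : d ∈ edges A i) :
    ∃ p < A.length, ∃ q < A.length, hasBit (row A p) (i + q) = true ∧
      d = ⟨Nat.lor (Nat.pow 2 (i + p)) (Nat.pow 2 (i + q)), Nat.lor (row A p) (row A q),
        Nat.land (row A p) (row A q)⟩ := by
  induction A generalizing i with
  | nil => simp [edges] at h
  | cons a A ih =>
    rcases mem_rowEdges h with h | ⟨q, hq, h1, h2⟩
    · obtain ⟨p, hp, q, hq, h1, h2⟩ := ih h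
      refine ⟨p + 1, by simpa using hp, q + 1, by simpa using hq, ?_, ?_⟩
      · rw [show i + (q + 1) = i + 1 + q by omega]
        simpa [row] using h1
      · rw [h2, show i + (p + 1) = i + 1 + p by omega, show i + (q + 1) = i + 1 + q by omega]
        simp [row]
    · refine ⟨0, by simp, q + 1, by simpa using hq, ?_, ?_⟩
      · rw [show i + (q + 1) = i + 1 + q by omega]
        simpa [row] using h1
      · rw [h2, show i + (q + 1) = i + 1 + q by omega]
        simp [row]

/-- A vertex with neighbourhood `S` creates neither a `2K₂` nor a `K₄` with the given edge. -/
def edgeOK (S : ℕ) : EdgeData → Bool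
  | ⟨e, u, t⟩ =>
    bif Nat.beq (Nat.land S e) 0 then Nat.beq (Nat.land S u) S
    else bif Nat.beq (Nat.land e S) e then Nat.beq (Nat.land S t) 0 else true

/-- A vertex with neighbourhood `S` creates neither a `2K₂` nor a `K₄` with the given edges. -/
def edgesOK (S : ℕ) : List EdgeData → Bool
  | [] => true
  | e :: l => bif edgeOK S e then edgesOK S l else false

theorem edgesOK_of_forall {S : ℕ} {l : List EdgeData} (h : ∀ e ∈ l, edgeOK S e = true) :
    edgesOK S l = true := by
  induction l with
  | nil => rfl
  | cons e l ih =>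
    rw [edgesOK, h e (by simp), cond_true]
    exact ih fun e he => h e (by simp [he])

/-- The indices of the rows after the `k`-th one with fewer than four digits `1`. -/
def openIndices (n k : ℕ) : List ℕ → ℕ → List ℕ
  | [], _ => []
  | a :: A, i =>
    bif Nat.blt k i && Nat.blt (bitCount a n) 4 then i :: openIndices n k A (Nat.succ i)
    else openIndices n k A (Nat.succ i)

theorem le_of_mem_openIndices {n k : ℕ} {A : List ℕ} {i j : ℕ} (h : j ∈ openIndices n k A i) :
    i ≤ j := by
  induction A generalizing i with
  | nil => simp [openIndices] at h
  | cons a A ih =>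
    rw [openIndices] at h
    cases hc : (Nat.blt k i && Nat.blt (bitCount a n) 4)
    · rw [hc] at h
      exact (Nat.le_succ i).trans (ih h)
    · rw [hc, cond_true, List.mem_cons] at h
      rcases h with rfl | h
      · exact le_rfl
      · exact (Nat.le_succ i).trans (ih h)

theorem nodup_openIndices (n k : ℕ) (A : List ℕ) (i : ℕ) : (openIndices n k A i).Nodup := by
  induction A generalizing i with
  | nil => simp [openIndices]
  | cons a A ih =>
    rw [openIndices]
    cases (Nat.blt k i && Nat.blt (bitCount a n) 4)
    · exact ih _
    · rw [cond_true, List.nodup_cons]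
      exact ⟨fun h => by have := le_of_mem_openIndices h; omega, ih _⟩

theorem mem_openIndices {n k : ℕ} {A : List ℕ} {i j : ℕ} (hj : j < A.length) (hk : k < i + j)
    (hc : bitCount (row A j) n < 4) : i + j ∈ openIndices n k A i := by
  induction A generalizing i j with
  | nil => simp at hj
  | cons a A ih =>
    cases j with
    | zero =>
      have h1 : Nat.blt k i = true := by simpa [Nat.blt_eq] using hk
      have h2 : Nat.blt (bitCount a n) 4 = true := by simpa [Nat.blt_eq, row] using hc
      simp [openIndices, h1, h2]
    | succ j =>
      have := ih (i := i + 1) (j := j) (by simpa using hj) (by omega) (by simpa [row] using hc)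
      rw [show i + (j + 1) = i + 1 + j by omega, openIndices]
      cases (Nat.blt k i && Nat.blt (bitCount a n) 4)
      · exact this
      · rw [cond_true]
        exact List.mem_cons_of_mem _ this

theorem lt_of_mem_openIndices {n k : ℕ} {A : List ℕ} {i j : ℕ} (h : j ∈ openIndices n k A i) :
    k < j := by
  induction A generalizing i with
  | nil => simp [openIndices] at h
  | cons a A ih =>
    rw [openIndices] at h
    cases hc : (Nat.blt k i && Nat.blt (bitCount a n) 4)
    · rw [hc] at h
      exact ih h
    · rw [hc, cond_true, List.mem_cons] at h
      rcases h with rfl | h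
      · rw [Bool.and_eq_true, Nat.blt_eq] at hc
        exact hc.1
      · exact ih h

/-! ### Searching for 3-colourings and isomorphisms -/

/-- The rows in the list, numbered from `i`, extend a partial colouring with colour classes
`x`, `y`, `z`. -/
def color3 : List ℕ → ℕ → ℕ → ℕ → ℕ → Bool
  | [], _, _, _, _ => true
  | a :: A, i, x, y, z =>
    (Nat.beq (Nat.land a x) 0 && color3 A (Nat.succ i) (Nat.lor x (Nat.pow 2 i)) y z) ||
    ((Nat.beq (Nat.land a y) 0 && color3 A (Nat.succ i) x (Nat.lor y (Nat.pow 2 i)) z) ||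
      (Nat.beq (Nat.land a z) 0 && color3 A (Nat.succ i) x y (Nat.lor z (Nat.pow 2 i))))

/-- Comparing each vertex with earlier ones suffices for a symmetric matrix. The initial masks `m`
may contain digits of vertices outside the list; this allows an extra vertex to be precoloured. -/
theorem color3_spec {A : List ℕ} {i : ℕ} (m : Fin 3 → ℕ)
    (h : color3 A i (m 0) (m 1) (m 2) = true) :
    ∃ c : ℕ → Fin 3, ∀ t < A.length, Nat.land (row A t) (m (c t)) = 0 ∧
      ∀ s < t, hasBit (row A t) (i + s) = true → c s ≠ c t := by
  induction A generalizing i m with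
  | nil => exact ⟨fun _ => 0, by simp⟩
  | cons a A ih =>
    obtain ⟨k, hk, h'⟩ : ∃ k : Fin 3, Nat.land a (m k) = 0 ∧
        color3 A (i + 1) (Function.update m k (Nat.lor (m k) (Nat.pow 2 i)) 0)
          (Function.update m k (Nat.lor (m k) (Nat.pow 2 i)) 1)
          (Function.update m k (Nat.lor (m k) (Nat.pow 2 i)) 2) = true := by
      simp only [color3, Bool.or_eq_true, Bool.and_eq_true, Nat.beq_eq] at h
      rcases h with h | h | h
      · exact ⟨0, h.1, h.2⟩
      · exact ⟨1, h.1, h.2⟩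
      · exact ⟨2, h.1, h.2⟩
    obtain ⟨c, hc⟩ := ih _ h'
    refine ⟨fun t => Nat.casesOn t k c, fun t ht => ?_⟩
    cases t with
    | zero => exact ⟨hk, by simp⟩
    | succ t =>
      obtain ⟨h1, h2⟩ := hc t (by simpa using ht)
      have hrow : row (a :: A) (t + 1) = row A t := rfl
      rw [hrow]
      by_cases hct : c t = k
      · rw [hct, Function.update_self, land_eq_zero_iff] at h1
        have h3 : ∀ j, hasBit (row A t) j = true → hasBit (m k) j = false ∧ i ≠ j := by
          intro j hj
          have := h1 j hj
          rw [hasBit_lor, hasBit_pow, Bool.or_eq_false_iff, decide_eq_false_iff_not] at this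
          exact this
        refine ⟨?_, fun s hs hb => ?_⟩
        · change Nat.land _ (m (c t)) = 0
          rw [hct]
          exact land_eq_zero_iff.2 fun j hj => (h3 j hj).1
        · cases s with
          | zero => exact absurd rfl (h3 i hb).2
          | succ s => exact h2 s (by omega) (by rwa [show i + 1 + s = i + (s + 1) by omega])
      · rw [Function.update_of_ne hct] at h1
        refine ⟨h1, fun s hs hb => ?_⟩
        cases s with
        | zero => exact Ne.symm hct
        | succ s => exact h2 s (by omega) (by rwa [show i + 1 + s = i + (s + 1) by omega])

/-- Mapping a vertex with row `r` to the vertex `c` with row `a` is compatible with mapping the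
vertices numbered from `t` to those in the list. -/
def compatible (a r c : ℕ) : List ℕ → ℕ → Bool
  | [], _ => true
  | d :: l, t =>
    !(Nat.beq c d) && ((hasBit a d == hasBit r t) && compatible a r c l (Nat.succ t))

theorem compatible_spec {a r c : ℕ} {l : List ℕ} {t : ℕ} (h : compatible a r c l t = true) {s : ℕ}
    (hs : s < l.length) : c ≠ row l s ∧ hasBit a (row l s) = hasBit r (t + s) := by
  induction l generalizing t s with
  | nil => simp at hs
  | cons d l ih =>
    simp only [compatible, Bool.and_eq_true, Bool.not_eq_true', beq_iff_eq] at h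
    cases s with
    | zero =>
      refine ⟨fun hcd => Bool.false_ne_true (h.1.symm.trans ?_), h.2.1⟩
      rw [hcd]
      exact Nat.beq_refl _
    | succ s =>
      have := ih h.2.2 (s := s) (by simpa using hs)
      rwa [show t.succ + s = t + (s + 1) by omega] at this

/-- Extend a partial embedding `acc` into the graph with matrix `A` of order `n` to the vertices
whose rows are listed. -/
def embeds (n : ℕ) (A : List ℕ) : List ℕ → List ℕ → Bool
  | [], _ => true
  | r :: F, acc =>
    (List.range n).any fun c => compatible (row A c) r c acc 0 && embeds n A F (acc ++ [c])

theorem embeds_spec {n : ℕ} {A F acc : List ℕ} (h : embeds n A F acc = true) :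
    ∃ φ : ℕ → ℕ, (∀ s < acc.length, φ s = row acc s) ∧ ∀ t < F.length,
      φ (acc.length + t) < n ∧ ∀ s < acc.length + t, φ (acc.length + t) ≠ φ s ∧
        hasBit (row A (φ (acc.length + t))) (φ s) = hasBit (row F t) s := by
  induction F generalizing acc with
  | nil => exact ⟨row acc, fun _ _ => rfl, by simp⟩
  | cons r F ih =>
    simp only [embeds, List.any_eq_true, List.mem_range, Bool.and_eq_true] at h
    obtain ⟨c, hc, h1, h2⟩ := h
    obtain ⟨φ, hφ, hF⟩ := ih h2
    have hlen : (acc ++ [c]).length = acc.length + 1 := by simp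
    rw [hlen] at hφ hF
    have hφ' : ∀ s < acc.length, φ s = row acc s := by
      intro s hs
      rw [hφ s (by omega), row, row, List.getD_append _ _ _ _ hs]
    have hφc : φ acc.length = c := by
      rw [hφ _ (by omega), row, List.getD_append_right _ _ _ _ le_rfl]
      simp
    refine ⟨φ, hφ', fun t ht => ?_⟩
    cases t with
    | zero =>
      rw [Nat.add_zero, hφc]
      refine ⟨hc, fun s hs => ?_⟩
      have := compatible_spec h1 hs
      rw [Nat.zero_add] at this
      rw [hφ' s hs]
      exact this
    | succ t =>
      have := hF t (by simpa using ht)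
      rw [show acc.length + (t + 1) = acc.length + 1 + t by omega]
      exact this

/-- The adjacency matrix of `exceptionA`. -/
def rowsA : List ℕ := [14, 49, 81, 97, 102, 90, 60]

/-- The adjacency matrix of `exceptionB`. -/
def rowsB : List ℕ := [14, 49, 89, 101, 102, 90, 60]

/-- The adjacency matrix of `exceptionC`. -/
def rowsC : List ℕ := [60, 120, 113, 99, 71, 15, 30]

/-- The adjacency matrix of `exceptionD`. -/
def rowsD : List ℕ := [14, 177, 209, 225, 102, 90, 60, 14]

theorem exceptionA_adj (i j : Fin 7) : exceptionA.Adj i j ↔ hasBit (row rowsA i) j = true := by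
  simp only [exceptionA, SimpleGraph.fromEdgeSet_adj, Set.mem_insert_iff, Set.mem_singleton_iff]
  revert i j
  decide

theorem exceptionB_adj (i j : Fin 7) : exceptionB.Adj i j ↔ hasBit (row rowsB i) j = true := by
  simp only [exceptionB, SimpleGraph.fromEdgeSet_adj, Set.mem_insert_iff, Set.mem_singleton_iff]
  revert i j
  decide

theorem exceptionC_adj (i j : Fin 7) : exceptionC.Adj i j ↔ hasBit (row rowsC i) j = true := by
  have h : (SimpleGraph.cycleGraph 7).Adj i j ↔ (i - j = 1 ∨ j - i = 1) :=
    SimpleGraph.cycleGraph_adj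
  rw [exceptionC, SimpleGraph.compl_adj, h]
  clear h
  revert i j
  decide

theorem exceptionD_adj (i j : Fin 8) : exceptionD.Adj i j ↔ hasBit (row rowsD i) j = true := by
  simp only [exceptionD, SimpleGraph.fromEdgeSet_adj, Set.mem_insert_iff, Set.mem_singleton_iff]
  revert i j
  decide

/-! ### Exhaustive search for `2K₂`-free, `K₄`-free graphs of maximum degree at most four -/

/-- The graph with matrix `A` of order `n` is 3-colourable or one of the exceptional graphs. -/
def finalCheck (n : ℕ) (A : List ℕ) : Bool :=
  color3 A 0 0 0 0 ||
    (Nat.beq n 7 && (embeds n A rowsA [] || (embeds n A rowsB [] || embeds n A rowsC [])) ||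
      Nat.beq n 8 && embeds n A rowsD [])

/-- All extensions of the graph with matrix `A` of order `n` in which the vertices before the
`k`-th one get no new neighbours pass the final check; `r` bounds the depth of the search. -/
def search : ℕ → ℕ → ℕ → List ℕ → Bool
  | 0, _, _, _ => false
  | r + 1, n, k, A =>
    bif Nat.beq k n then finalCheck n A
    else search r n (Nat.succ k) A &&
      (Nat.ble 4 (bitCount (row A k) n) ||
        forallMasks (fun S => !(edgesOK S (edges A 0)) ||
            search r (Nat.succ n) k (addVertex (Nat.pow 2 n) S A 0))
          (openIndices n k A 0) 3 (Nat.pow 2 k))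

-- The rows 110, 101, 011 in binary are a triangle. The 30 is fuel: running out of it returns
-- `false`, so the evaluation also certifies that the search ends in time.
set_option maxRecDepth 100000 in
theorem search_triangle : search 30 3 0 [6, 5, 3] = true := by decide +kernel

/-! ### Soundness of the search. -/

section Soundness

variable {V : Type*} {G : SimpleGraph V}

/-- The vertices `f 0, …, f (n - 1)` are not isolated and span an induced subgraph with
matrix `A`. -/
structure Realizes (G : SimpleGraph V) (f : ℕ → V) (n : ℕ) (A : List ℕ) : Prop where
  length_eq : A.length = n
  inj : ∀ i < n, ∀ j < n, f i = f j → i = j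
  adj : ∀ i < n, ∀ j, hasBit (row A i) j = true ↔ j < n ∧ G.Adj (f i) (f j)
  mem_support : ∀ i < n, f i ∈ G.support

theorem Realizes.card_le {f : ℕ → V} {n : ℕ} {A : List ℕ} (hR : Realizes G f n A)
    (hd : DegreeAtMost G 4) (v : V) (s : Finset ℕ)
    (hs : ∀ j ∈ s, j < n ∧ G.Adj v (f j)) : s.card ≤ 4 := by
  classical
  rw [← Finset.card_image_of_injOn (s := s) (f := f)]
  · refine hd v _ fun t ht => ?_
    obtain ⟨j, hj, rfl⟩ := Finset.mem_image.1 ht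
    exact (hs j hj).2
  · exact fun i hi j hj => hR.inj i (hs i hi).1 j (hs j hj).1

theorem Realizes.addVertex {f : ℕ → V} {n : ℕ} {A : List ℕ} (hR : Realizes G f n A) {x : V}
    (hx : ∀ i < n, f i ≠ x) (hsupp : x ∈ G.support) {S : ℕ}
    (hS : ∀ j, hasBit S j = true ↔ j < n ∧ G.Adj x (f j)) :
    Realizes G (Function.update f n x) (n + 1) (addVertex (Nat.pow 2 n) S A 0) := by
  have hf : ∀ i < n, Function.update f n x i = f i := fun i hi =>
    Function.update_of_ne hi.ne _ _
  have hn : Function.update f n x n = x := Function.update_self _ _ _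
  refine ⟨by rw [addVertex_length, hR.length_eq], fun i hi j hj h => ?_, fun i hi j => ?_,
    fun i hi => ?_⟩
  · rcases Nat.lt_succ_iff_lt_or_eq.1 hi with hi | rfl <;>
      rcases Nat.lt_succ_iff_lt_or_eq.1 hj with hj | rfl
    · rw [hf i hi, hf j hj] at h
      exact hR.inj i hi j hj h
    · rw [hf i hi, hn] at h
      exact absurd h (hx i hi)
    · rw [hf j hj, hn] at h
      exact absurd h.symm (hx j hj)
    · rfl
  · rcases Nat.lt_succ_iff_lt_or_eq.1 hi with hi | rfl
    · rw [row_addVertex_of_lt _ _ _ _ _ (hR.length_eq ▸ hi), Nat.zero_add, hf i hi]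
      have h1 : hasBit (bif hasBit S i then Nat.lor (row A i) (Nat.pow 2 n) else row A i) j = true ↔
          hasBit (row A i) j = true ∨ (hasBit S i = true ∧ n = j) := by
        cases hasBit S i
        · simp
        · rw [cond_true, hasBit_lor, hasBit_pow, Bool.or_eq_true, decide_eq_true_iff]
          simp
      rw [h1, hR.adj i hi, hS]
      constructor
      · rintro (⟨h2, h3⟩ | ⟨⟨h2, h3⟩, rfl⟩)
        · rw [hf j h2]
          exact ⟨by omega, h3⟩
        · rw [hn]
          exact ⟨by omega, h3.symm⟩
      · rintro ⟨h2, h3⟩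
        rcases Nat.lt_succ_iff_lt_or_eq.1 h2 with h2 | rfl
        · rw [hf j h2] at h3
          exact .inl ⟨h2, h3⟩
        · rw [hn] at h3
          exact .inr ⟨⟨hi, h3.symm⟩, rfl⟩
    · have := row_addVertex_length (Nat.pow 2 i) S A 0
      rw [hR.length_eq] at this
      rw [this, hS, hn]
      constructor
      · rintro ⟨h2, h3⟩
        rw [hf j h2]
        exact ⟨by omega, h3⟩
      · rintro ⟨h2, h3⟩
        rcases Nat.lt_succ_iff_lt_or_eq.1 h2 with h2 | rfl
        · rw [hf j h2] at h3
          exact ⟨h2, h3⟩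
        · rw [hn] at h3
          exact absurd h3 G.irrefl
  · rcases Nat.lt_succ_iff_lt_or_eq.1 hi with hi | rfl
    · rw [hf i hi]
      exact hR.mem_support i hi
    · rwa [hn]

theorem not_four_clique (h : G.CliqueFree 4) {a b c d : V} (hab : G.Adj a b) (hac : G.Adj a c)
    (had : G.Adj a d) (hbc : G.Adj b c) (hbd : G.Adj b d) : ¬ G.Adj c d := by
  classical
  intro hcd
  refine h (insert a {b, c, d}) ((SimpleGraph.is3Clique_triple_iff.2 ⟨hbc, hbd, hcd⟩).insert ?_)
  simp [hab, hac, had]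

/-- If x misses both ends of an edge, then each neighbour of x must see one of the ends, or the two
edges would form a 2K₂. Both the pruning of the search and `pairsOK` rest on this. -/
theorem Realizes.land_union_eq {f : ℕ → V} {n : ℕ} {A : List ℕ} (hR : Realizes G f n A)
    (hG : TwoK2Free G) {x : V} {S : ℕ} (hS : ∀ j, hasBit S j = true ↔ j < n ∧ G.Adj x (f j))
    {p q : ℕ} (hp : p < n) (hq : q < n) (hpq : hasBit (row A p) q = true)
    (h : Nat.land S (Nat.lor (Nat.pow 2 p) (Nat.pow 2 q)) = 0) :
    Nat.land S (Nat.lor (row A p) (row A q)) = S := by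
  have hadj := ((hR.adj p hp q).1 hpq).2
  have hends : ∀ j, hasBit (Nat.lor (Nat.pow 2 p) (Nat.pow 2 q)) j = true ↔ p = j ∨ q = j := by
    intro j
    rw [hasBit_lor, hasBit_pow, hasBit_pow]
    simp
  rw [land_eq_zero_iff] at h
  rw [land_eq_left_iff]
  intro j hj
  have hnp : ¬ G.Adj x (f p) := fun hp' => by
    have := h p ((hS p).2 ⟨hp, hp'⟩)
    rw [(hends p).2 (.inl rfl)] at this
    exact absurd this (by simp)
  have hnq : ¬ G.Adj x (f q) := fun hq' => by
    have := h q ((hS q).2 ⟨hq, hq'⟩)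
    rw [(hends q).2 (.inr rfl)] at this
    exact absurd this (by simp)
  obtain ⟨hjn, hxj⟩ := (hS j).1 hj
  rw [hasBit_lor, Bool.or_eq_true, hR.adj p hp, hR.adj q hq]
  rcases hG.adj_cross hxj hadj with h | h | h | h
  · exact absurd h hnp
  · exact absurd h hnq
  · exact .inl ⟨hjn, h.symm⟩
  · exact .inr ⟨hjn, h.symm⟩

theorem Realizes.edgesOK {f : ℕ → V} {n : ℕ} {A : List ℕ} (hR : Realizes G f n A)
    (hG : TwoK2Free G) (h4 : G.CliqueFree 4) {x : V} {S : ℕ}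
    (hS : ∀ j, hasBit S j = true ↔ j < n ∧ G.Adj x (f j)) : edgesOK S (edges A 0) = true := by
  classical
  refine edgesOK_of_forall fun d hd => ?_
  obtain ⟨p, hp, q, hq, hpq, rfl⟩ := mem_edges hd
  rw [hR.length_eq] at hp hq
  rw [Nat.zero_add] at hpq ⊢
  have hadj := ((hR.adj p hp q).1 hpq).2
  rw [Nat.zero_add, edgeOK]
  have hends : ∀ j, hasBit (Nat.lor (Nat.pow 2 p) (Nat.pow 2 q)) j = true ↔ p = j ∨ q = j := by
    intro j
    rw [hasBit_lor, hasBit_pow, hasBit_pow]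
    simp
  have hdisj := fun h => hR.land_union_eq hG hS hp hq hpq h
  have hsub : Nat.land (Nat.lor (Nat.pow 2 p) (Nat.pow 2 q)) S =
      Nat.lor (Nat.pow 2 p) (Nat.pow 2 q) → Nat.land S (Nat.land (row A p) (row A q)) = 0 := by
    rw [land_eq_zero_iff, land_eq_left_iff]
    intro h j hj
    have hxp := ((hS p).1 (h p ((hends p).2 (.inl rfl)))).2
    have hxq := ((hS q).1 (h q ((hends q).2 (.inr rfl)))).2
    obtain ⟨hjn, hxj⟩ := (hS j).1 hj
    by_contra hb
    rw [Bool.not_eq_false, hasBit_land, Bool.and_eq_true, hR.adj p hp, hR.adj q hq] at hb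
    exact not_four_clique h4 hxp hxq hxj hadj hb.1.2 hb.2.2
  cases h1 : Nat.beq (Nat.land S (Nat.lor (Nat.pow 2 p) (Nat.pow 2 q))) 0
  · rw [cond_false]
    cases h2 : Nat.beq (Nat.land (Nat.lor (Nat.pow 2 p) (Nat.pow 2 q)) S)
        (Nat.lor (Nat.pow 2 p) (Nat.pow 2 q))
    · rfl
    · rw [cond_true, hsub (Nat.eq_of_beq_eq_true h2)]
      rfl
  · rw [cond_true, hdisj (Nat.eq_of_beq_eq_true h1)]
    exact Nat.beq_refl S

/-- The outside vertex x is one more neighbour of `f j` besides those recorded in its row. -/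
theorem Realizes.bitCount_lt {f : ℕ → V} {n : ℕ} {A : List ℕ} (hR : Realizes G f n A)
    (hd : DegreeAtMost G 4) {x : V} (hx : ∀ i < n, f i ≠ x) {j : ℕ} (hj : j < n)
    (hxj : G.Adj x (f j)) : bitCount (row A j) n < 4 := by
  classical
  rw [bitCount_eq_card, ← Finset.card_image_of_injOn (f := f)]
  · have hmem : x ∉ ((Finset.range n).filter fun i => hasBit (row A j) i = true).image f := by
      rw [Finset.mem_image]
      rintro ⟨i, hi, rfl⟩
      exact hx i (Finset.mem_range.1 (Finset.mem_filter.1 hi).1) rfl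
    have := hd (f j) (insert x
      (((Finset.range n).filter fun i => hasBit (row A j) i = true).image f)) (by
        intro t ht
        rcases Finset.mem_insert.1 ht with rfl | ht
        · exact hxj.symm
        · obtain ⟨i, hi, rfl⟩ := Finset.mem_image.1 ht
          exact ((hR.adj j hj i).1 (Finset.mem_filter.1 hi).2).2)
    rw [Finset.card_insert_of_notMem hmem] at this
    omega
  · intro i hi j hj
    simp only [Finset.coe_filter, Finset.mem_range, Set.mem_ofPred_eq] at hi hj
    exact hR.inj i hi.1 j hj.1

/-- A graph embedded onto the set of non-isolated vertices of `G`. -/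
theorem nonempty_iso_of_range_eq_support {W : Type*} {F : SimpleGraph W} (g : W → V)
    (hinj : Function.Injective g) (hadj : ∀ i j, F.Adj i j ↔ G.Adj (g i) (g j))
    (hrange : ∀ v, v ∈ G.support ↔ ∃ i, g i = v) : Nonempty (G.induce G.support ≃g F) := by
  have hb : Function.Bijective fun i : W => (⟨g i, (hrange _).2 ⟨i, rfl⟩⟩ : G.support) := by
    refine ⟨fun i j h => hinj (congrArg Subtype.val h), fun ⟨v, hv⟩ => ?_⟩
    obtain ⟨i, rfl⟩ := (hrange v).1 hv
    exact ⟨i, rfl⟩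
  refine ⟨RelIso.symm ⟨Equiv.ofBijective _ hb, ?_⟩⟩
  intro i j
  exact (hadj i j).symm

theorem Realizes.nonempty_iso {f : ℕ → V} {n : ℕ} {A : List ℕ} (hR : Realizes G f n A)
    (hsupp : ∀ v ∈ G.support, ∃ i < n, f i = v) {F : SimpleGraph (Fin n)} {rows : List ℕ}
    (hlen : rows.length = n) (hF : ∀ i j : Fin n, F.Adj i j ↔ hasBit (row rows i) j = true)
    (h : embeds n A rows [] = true) : Nonempty (G.induce G.support ≃g F) := by
  obtain ⟨φ, -, hφ⟩ := embeds_spec h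
  simp only [List.length_nil, Nat.zero_add, hlen] at hφ
  have hlt : ∀ i : Fin n, φ i < n := fun i => (hφ i i.2).1
  have hinj : Function.Injective fun i : Fin n => (⟨φ i, hlt i⟩ : Fin n) := by
    intro i j hij
    have hij' : φ i = φ j := congrArg Fin.val hij
    rcases lt_trichotomy i j with h | h | h
    · exact absurd hij'.symm ((hφ j j.2).2 i h).1
    · exact h
    · exact absurd hij' ((hφ i i.2).2 j h).1
  -- Both graphs have order n, so an induced embedding is already an isomorphism.
  have hsurj := Finite.surjective_of_injective hinj
  refine nonempty_iso_of_range_eq_support (fun i : Fin n => f (φ i)) ?_ ?_ ?_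
  · intro i j hij
    exact hinj (Fin.ext (hR.inj _ (hlt i) _ (hlt j) hij))
  · have key : ∀ i j : Fin n, j < i → (F.Adj i j ↔ G.Adj (f (φ i)) (f (φ j))) := by
      intro i j hji
      rw [hF, ← ((hφ i i.2).2 j hji).2, hR.adj _ (hlt i)]
      exact and_iff_right (hlt j)
    intro i j
    rcases lt_trichotomy i j with h | rfl | h
    · rw [F.adj_comm, G.adj_comm]
      exact key j i h
    · exact iff_of_false F.irrefl G.irrefl
    · exact key i j h
  · intro v
    constructor
    · intro hv
      obtain ⟨i, hi, rfl⟩ := hsupp v hv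
      obtain ⟨j, hj⟩ := hsurj ⟨i, hi⟩
      exact ⟨j, congrArg f (congrArg Fin.val hj)⟩
    · rintro ⟨i, rfl⟩
      exact hR.mem_support _ (hlt i)

theorem Realizes.of_finalCheck {f : ℕ → V} {n : ℕ} {A : List ℕ} (hR : Realizes G f n A)
    (hsupp : ∀ v ∈ G.support, ∃ i < n, f i = v) (h : finalCheck n A = true) :
    G.Colorable 3 ∨ IsExceptional (G.induce G.support) := by
  classical
  simp only [finalCheck, Bool.or_eq_true, Bool.and_eq_true] at h
  rcases h with h | ⟨hn, h | h | h⟩ | ⟨hn, h⟩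
  · left
    obtain ⟨c, hc⟩ := color3_spec (fun _ => 0) h
    rw [hR.length_eq] at hc
    have hc' : ∀ i < n, ∀ j < n, G.Adj (f i) (f j) → c i ≠ c j := by
      intro i hi j hj hij
      rcases lt_trichotomy i j with h | rfl | h
      · exact (hc j hj).2 i h (by rw [Nat.zero_add]; exact (hR.adj j hj i).2 ⟨hi, hij.symm⟩)
      · exact absurd hij G.irrefl
      · exact ((hc i hi).2 j h (by rw [Nat.zero_add]; exact (hR.adj i hi j).2 ⟨hj, hij⟩)).symm
    choose! g hg using hsupp
    refine ⟨SimpleGraph.Coloring.mk (fun v => c (g v)) fun {v w} hvw => ?_⟩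
    have hv := hg v ⟨w, hvw⟩
    have hw := hg w ⟨v, hvw.symm⟩
    exact hc' _ hv.1 _ hw.1 (by rwa [hv.2, hw.2])
  · obtain rfl := Nat.eq_of_beq_eq_true hn
    exact .inr (.inl (hR.nonempty_iso hsupp rfl exceptionA_adj h))
  · obtain rfl := Nat.eq_of_beq_eq_true hn
    exact .inr (.inr (.inl (hR.nonempty_iso hsupp rfl exceptionB_adj h)))
  · obtain rfl := Nat.eq_of_beq_eq_true hn
    exact .inr (.inr (.inr (.inl (hR.nonempty_iso hsupp rfl exceptionC_adj h))))
  · obtain rfl := Nat.eq_of_beq_eq_true hn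
    exact .inr (.inr (.inr (.inr (hR.nonempty_iso hsupp rfl exceptionD_adj h))))

/-- The invariant `hcl` says that all neighbours of the vertices before `k` have been found. If
vertex `k` has the same property, `k` advances; otherwise a missing neighbour is appended, and its
neighbourhood is among the masks tried. -/
theorem Realizes.of_search (hG : TwoK2Free G) (hd : DegreeAtMost G 4) (h4 : G.CliqueFree 4)
    {r n k : ℕ} {A : List ℕ} {f : ℕ → V} (hR : Realizes G f n A) (hn : 0 < n) (hk : k ≤ n)
    (hcl : ∀ i < k, ∀ x, G.Adj (f i) x → ∃ j < n, f j = x) (h : search r n k A = true) :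
    G.Colorable 3 ∨ IsExceptional (G.induce G.support) := by
  classical
  induction r generalizing n k A f with
  | zero => simp [search] at h
  | succ r ih =>
    rw [search] at h
    cases hkn : Nat.beq k n
    · rw [hkn, cond_false, Bool.and_eq_true, Bool.or_eq_true] at h
      have hlt : k < n := lt_of_le_of_ne hk (Nat.ne_of_beq_eq_false hkn)
      by_cases hc : ∀ x, G.Adj (f k) x → ∃ j < n, f j = x
      · refine ih hR hn hlt (fun i hi => ?_) h.1
        rcases Nat.lt_succ_iff_lt_or_eq.1 hi with hi | rfl
        · exact hcl i hi
        · exact hc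
      · push Not at hc
        obtain ⟨x, hkx, hx⟩ := hc
        obtain ⟨S, hS⟩ := exists_mask (fun j => G.Adj x (f j)) n
        have hbit := fun {j} (hj : j < n) (hxj : G.Adj x (f j)) => hR.bitCount_lt hd hx hj hxj
        have hall := h.2.resolve_left fun h' => by
          have := hbit hlt hkx.symm
          have := Nat.le_of_ble_eq_true h'
          omega
        have hchk := forallMasks_spec (S := S) (nodup_openIndices n k A 0) hall
          (fun j hj => by
            rw [hasBit_pow, decide_eq_true_iff] at hj
            exact (hS j).2 (hj ▸ ⟨hlt, hkx.symm⟩))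
          -- The new vertex sees no vertex before `k`, as those are complete, and any later one that
          -- it sees still has room for a neighbour.
          (fun j hj => by
            obtain ⟨hjn, hxj⟩ := (hS j).1 hj
            rw [hasBit_pow, decide_eq_true_iff]
            rcases lt_trichotomy j k with hjk | hjk | hjk
            · obtain ⟨i, hi, hix⟩ := hcl j hjk x hxj.symm
              exact absurd hix (hx i hi)
            · exact .inl hjk.symm
            · right
              have := mem_openIndices (i := 0) (hR.length_eq.symm ▸ hjn) (by rwa [Nat.zero_add])
                (hbit hjn hxj)
              rwa [Nat.zero_add] at this)
          -- The budget is 3 because `k` itself uses up one of the at most four neighbours.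
          (by
            have hnd := (nodup_openIndices n k A 0).filter (fun j => hasBit S j)
            have hkn : k ∉ ((openIndices n k A 0).filter (fun j => hasBit S j)).toFinset := by
              rw [List.mem_toFinset, List.mem_filter]
              exact fun h => (lt_of_mem_openIndices h.1).ne rfl
            have := hR.card_le hd x (insert k
              ((openIndices n k A 0).filter (fun j => hasBit S j)).toFinset) (by
                intro j hj
                rcases Finset.mem_insert.1 hj with rfl | hj
                · exact ⟨hlt, hkx.symm⟩
                · rw [List.mem_toFinset, List.mem_filter] at hj
                  exact (hS j).1 hj.2)
            rw [Finset.card_insert_of_notMem hkn, List.toFinset_card_of_nodup hnd] at this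
            omega)
        rw [hR.edgesOK hG h4 hS, Bool.not_true, Bool.false_or] at hchk
        refine ih (hR.addVertex hx ⟨f k, hkx.symm⟩ hS) (Nat.succ_pos n) (by omega)
          (fun i hi y hy => ?_) hchk
        rw [Function.update_of_ne (by omega)] at hy
        obtain ⟨j, hj, hjy⟩ := hcl i hi y hy
        exact ⟨j, by omega, by rw [Function.update_of_ne (by omega)]; exact hjy⟩
    · obtain rfl := Nat.eq_of_beq_eq_true hkn
      rw [hkn, cond_true] at h
      refine hR.of_finalCheck (fun v hv => ?_) h
      obtain ⟨w, hvw⟩ := hv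
      -- The vertices found are now closed under adjacency and span an edge. Any other edge vw is
      -- linked to that edge by 2K₂-freeness, so v was found.
      obtain ⟨y, h0y⟩ := hR.mem_support 0 hn
      obtain ⟨j, hj, rfl⟩ := hcl 0 hn y h0y
      rcases hG.adj_cross h0y hvw with h | h | h | h
      · exact hcl 0 hn v h
      · obtain ⟨i, hi, rfl⟩ := hcl 0 hn w h
        exact hcl i hi v hvw.symm
      · exact hcl j hj v h
      · obtain ⟨i, hi, rfl⟩ := hcl j hj w h
        exact hcl i hi v hvw.symm

/-- The `2K₂`-free and `K₄`-free graphs of maximum degree at most four. -/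
theorem TwoK2Free.colorable_three_or_isExceptional (hG : TwoK2Free G) (hd : DegreeAtMost G 4)
    (h4 : G.CliqueFree 4) : G.Colorable 3 ∨ IsExceptional (G.induce G.support) := by
  classical
  by_cases h3 : G.CliqueFree 3
  · exact .inl (hG.colorable_three_of_cliqueFree_three h3)
  · rw [SimpleGraph.CliqueFree] at h3
    push Not at h3
    obtain ⟨t, ht⟩ := h3
    obtain ⟨a, b, c, hab, hac, hbc, rfl⟩ := SimpleGraph.is3Clique_iff.1 ht
    have hR : Realizes G (fun i => if i = 0 then a else if i = 1 then b else c) 3 [6, 5, 3] := by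
      have n1 := hab.ne
      have n2 := hac.ne
      have n3 := hbc.ne
      have n1' := hab.ne'
      have n2' := hac.ne'
      have n3' := hbc.ne'
      refine ⟨rfl, ?_, ?_, ?_⟩
      · intro i hi j hj
        interval_cases i <;> interval_cases j <;> simp_all
      · intro i hi j
        by_cases hj : j < 3
        · interval_cases i <;> interval_cases j <;>
            simp_all [row, hasBit_eq_testBit, SimpleGraph.adj_comm] <;> decide
        · refine iff_of_false ?_ (by tauto)
          rw [hasBit_eq_testBit, Bool.not_eq_true]
          apply Nat.testBit_eq_false_of_lt
          calc row [6, 5, 3] i < 2 ^ 3 := by interval_cases i <;> decide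
            _ ≤ 2 ^ j := Nat.pow_le_pow_right (by norm_num) (by omega)
      · intro i hi
        interval_cases i
        · exact ⟨b, hab⟩
        · exact ⟨c, hbc⟩
        · exact ⟨a, hac.symm⟩
    exact hR.of_search hG hd h4 (by norm_num) (by norm_num) (by simp) search_triangle

end Soundness

/-! ### Adding an independent set to an exceptional graph -/

/-- Delete the vertex `x` from a matrix, and join the vertices in `S` to a vertex with
mask `N`; `i` is the index of the first row. -/
def markedRows (x S N : ℕ) : List ℕ → ℕ → List ℕ
  | [], _ => []
  | a :: A, i =>
    (bif Nat.beq i x then 0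
      else Nat.lor (bif hasBit a x then Nat.xor a (Nat.pow 2 x) else a)
        (bif hasBit S i then N else 0)) :: markedRows x S N A (Nat.succ i)

theorem markedRows_length (x S N : ℕ) (A : List ℕ) (i : ℕ) :
    (markedRows x S N A i).length = A.length := by
  induction A generalizing i with
  | nil => rfl
  | cons a A ih => simp [markedRows, ih]

/-- Only this inclusion is needed: a colouring that also respects superfluous edges is still proper.
The row of x is excluded, being replaced by 0 to keep the numbering. -/
theorem hasBit_markedRows {x S N : ℕ} {A : List ℕ} {i t : ℕ} (ht : t < A.length)
    (hx : i + t ≠ x) {j : ℕ}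
    (h : (hasBit (row A t) j = true ∧ j ≠ x) ∨ (hasBit S (i + t) = true ∧ hasBit N j = true)) :
    hasBit (row (markedRows x S N A i) t) j = true := by
  induction A generalizing i t with
  | nil => simp at ht
  | cons a A ih =>
    cases t with
    | zero =>
      have hix : Nat.beq i x = false := by
        cases hb : Nat.beq i x
        · rfl
        · exact absurd (Nat.eq_of_beq_eq_true hb) hx
      change hasBit (bif Nat.beq i x then 0 else _) j = true
      rw [hix, cond_false, hasBit_lor, Bool.or_eq_true]
      rcases h with ⟨h1, h2⟩ | ⟨h1, h2⟩
      · left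
        have h1' : hasBit a j = true := h1
        cases hasBit a x
        · exact h1'
        · rw [hasBit_eq_testBit] at h1' ⊢
          change (a ^^^ 2 ^ x).testBit j = true
          rw [Nat.testBit_xor, h1', Nat.testBit_two_pow_of_ne (Ne.symm h2)]
          rfl
      · right
        have h1' : hasBit S i = true := h1
        rw [h1']
        exact h2
    | succ t =>
      have := ih (i := i + 1) (t := t) (by simpa using ht) (by omega)
        (by rw [show i + 1 + t = i + (t + 1) by omega]; simpa [row] using h)
      simpa [row, markedRows] using this

/-- The graph with matrix `A` of order `n`, without the vertex `x`, has a 3-colouring with a colour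
that is not used on `S`. -/
def avoidable (n : ℕ) (A : List ℕ) (S x : ℕ) : Bool :=
  color3 (markedRows x S (Nat.pow 2 n) A 0) 0 (Nat.pow 2 n) 0 0

/-- A vertex with neighbourhood `S` creates no `2K₂`. -/
def pairsOK (S : ℕ) (A : List ℕ) : Bool :=
  (edges A 0).all fun d =>
    bif Nat.beq (Nat.land S d.ends) 0 then Nat.beq (Nat.land S d.union) S else true

/-- `S` is a possible nonempty neighbourhood of at most five vertices for which no colouring of
the graph with matrix `A` of order `n` extends. -/
def obstructs (n : ℕ) (A : List ℕ) (S : ℕ) : Bool :=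
  !Nat.beq S 0 && (Nat.ble (bitCount S n) 5 && (pairsOK S A && (List.range n).all fun x =>
    !(hasBit S x && (Nat.beq (bitCount (row A x) n) 4 && avoidable n A S x))))

section Extension

variable {V : Type*} {G : SimpleGraph V}

/-- Let y be the only possible neighbour of `f x` in I. Colour the other vertices `f i` with 0, 1, 2
so that 0 does not occur on the neighbours of y. Then y, if it lies in I, takes 0, while `f x` and
the rest of I take 3. The remaining vertices have neighbours in I only, and I avoids the colour 1.
-/
theorem Realizes.colorable_four_of_avoidable {f : ℕ → V} {n : ℕ} {A : List ℕ}
    (hR : Realizes G f n A) {I : Set V} (hI : ∀ a ∈ I, ∀ b ∈ I, ¬ G.Adj a b)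
    (hfI : ∀ i < n, f i ∉ I)
    (hJ : ∀ v ∉ I, (∀ i < n, f i ≠ v) → ∀ w ∉ I, ¬ G.Adj v w) {x : ℕ} (hx : x < n) {y : V}
    (hy : ∀ w ∈ I, G.Adj (f x) w → w = y) {S : ℕ}
    (hS : ∀ j, hasBit S j = true ↔ j < n ∧ G.Adj y (f j)) (h : avoidable n A S x = true) :
    G.Colorable 4 := by
  classical
  -- The extra vertex numbered n stands for y and is precoloured 0.
  obtain ⟨c, hc⟩ := color3_spec ![Nat.pow 2 n, 0, 0] h
  rw [markedRows_length, hR.length_eq] at hc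
  simp only [Nat.zero_add] at hc
  have hcS : ∀ i < n, i ≠ x → G.Adj y (f i) → c i ≠ 0 := by
    intro i hi hix hyi hci
    have hn : hasBit (Nat.pow 2 n) n = true := (hasBit_pow n n).trans (by simp)
    have h1 := (hc i hi).1
    rw [hci, land_eq_zero_iff] at h1
    have h2 := h1 n (hasBit_markedRows (hR.length_eq ▸ hi) (by rwa [Nat.zero_add])
      (.inr ⟨by rw [Nat.zero_add]; exact (hS i).2 ⟨hi, hyi⟩, hn⟩))
    exact absurd (hn.symm.trans h2) (by simp)
  have hcc' : ∀ i < n, ∀ j < i, i ≠ x → j ≠ x → G.Adj (f i) (f j) → c j ≠ c i := by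
    intro i hi j hj hix hjx hij
    refine (hc i hi).2 j hj (hasBit_markedRows (hR.length_eq ▸ hi) (by rwa [Nat.zero_add])
      (.inl ⟨(hR.adj i hi j).2 ⟨by omega, hij⟩, hjx⟩))
  have hcc : ∀ i < n, ∀ j < n, i ≠ x → j ≠ x → G.Adj (f i) (f j) → c i ≠ c j := by
    intro i hi j hj hix hjx hij
    rcases lt_trichotomy i j with h | rfl | h
    · exact hcc' j hj i h hjx hix hij.symm
    · exact absurd hij G.irrefl
    · exact (hcc' i hi j h hix hjx hij).symm
  let col : V → Fin 4 := fun v =>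
    if v ∈ I then if v = y then 0 else 3
    else if hv : ∃ i < n, f i = v then if hv.choose = x then 3 else (c hv.choose).castSucc
    else 1
  have col_I : ∀ v ∈ I, v ≠ y → col v = 3 := fun v hv hvy => by simp [col, hv, hvy]
  have col_y : y ∈ I → col y = 0 := fun hv => by simp [col, hv]
  have col_J : ∀ v ∉ I, (∀ i < n, f i ≠ v) → col v = 1 := fun v hv hv' => by
    simp only [col]
    rw [if_neg hv, dif_neg (by push Not; exact hv')]
  have col_f : ∀ i < n, col (f i) = if i = x then 3 else (c i).castSucc := by
    intro i hi
    have hex : ∃ j < n, f j = f i := ⟨i, hi, rfl⟩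
    have hch : hex.choose = i := hR.inj _ hex.choose_spec.1 _ hi hex.choose_spec.2
    simp only [col]
    rw [if_neg (hfI i hi), dif_pos hex, hch]
  have hlast : ∀ a : Fin 3, a.castSucc ≠ (3 : Fin 4) := by decide
  have hIf : ∀ v ∈ I, ∀ i < n, G.Adj v (f i) → col v ≠ col (f i) := by
    intro v hv i hi hvi
    rw [col_f i hi]
    by_cases hvy : v = y
    · subst hvy
      rw [col_y hv]
      split_ifs with hix
      · decide
      · intro h0
        have : c i = 0 := Fin.castSucc_injective 3 h0.symm
        exact hcS i hi hix hvi this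
    · rw [col_I v hv hvy]
      rw [if_neg]
      · exact (hlast _).symm
      · rintro rfl
        exact hvy (hy v hv hvi.symm)
  have hIJ : ∀ v ∈ I, ∀ w ∉ I, (∀ i < n, f i ≠ w) → col v ≠ col w := by
    intro v hv w hw hw'
    rw [col_J w hw hw']
    by_cases hvy : v = y
    · subst hvy
      rw [col_y hv]
      decide
    · rw [col_I v hv hvy]
      decide
  have hI_out : ∀ v ∈ I, ∀ w ∉ I, G.Adj v w → col v ≠ col w := by
    intro v hv w hw hvw
    by_cases hw' : ∃ i < n, f i = w
    · obtain ⟨i, hi, rfl⟩ := hw'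
      exact hIf v hv i hi hvw
    · push Not at hw'
      exact hIJ v hv w hw hw'
  refine ⟨SimpleGraph.Coloring.mk col fun {v w} hvw => ?_⟩
  by_cases hv : v ∈ I <;> by_cases hw : w ∈ I
  · exact absurd hvw (hI v hv w hw)
  · exact hI_out v hv w hw hvw
  · exact (hI_out w hw v hv hvw.symm).symm
  · by_cases hv' : ∃ i < n, f i = v
    · by_cases hw' : ∃ i < n, f i = w
      · obtain ⟨i, hi, rfl⟩ := hv'
        obtain ⟨j, hj, rfl⟩ := hw'
        rw [col_f i hi, col_f j hj]
        split_ifs with h1 h2 h2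
        · subst h1 h2
          exact absurd hvw G.irrefl
        · exact (hlast _).symm
        · exact hlast _
        · exact fun h => hcc i hi j hj h1 h2 hvw (Fin.castSucc_injective 3 h)
      · push Not at hw'
        exact absurd hvw.symm (hJ w hw hw' v hv)
    · push Not at hv'
      exact absurd hvw (hJ v hv hv' w hw)

/-- A vertex with four neighbours outside I has exactly one neighbour in I: at least one by
maximality, at most one by the degree bound. `S x` is the trace of that neighbour on the vertices `f
i`. If another such vertex z lies in this trace, it has the same neighbour in I, whence `S z = S x`.
-/
theorem Realizes.exists_obstruction {f : ℕ → V} {n : ℕ} {A : List ℕ} (hR : Realizes G f n A)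
    (hG : TwoK2Free G) (hd : DegreeAtMost G 5) {I : Set V}
    (hI : ∀ a ∈ I, ∀ b ∈ I, ¬ G.Adj a b) (hmax : ∀ v ∉ I, ∃ y ∈ I, G.Adj v y)
    (hfI : ∀ i < n, f i ∉ I)
    (hJ : ∀ v ∉ I, (∀ i < n, f i ≠ v) → ∀ w ∉ I, ¬ G.Adj v w) (h4 : ¬ G.Colorable 4) :
    ∃ S : ℕ → ℕ, ∀ x < n, bitCount (row A x) n = 4 → hasBit (S x) x = true ∧ S x < 2 ^ n ∧
      obstructs n A (S x) = true ∧
      ∀ z < n, bitCount (row A z) n = 4 → hasBit (S x) z = true → S z = S x := by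
  classical
  have huniq : ∀ x < n, bitCount (row A x) n = 4 → ∀ y ∈ I, ∀ y' ∈ I, G.Adj (f x) y →
      G.Adj (f x) y' → y = y' := by
    intro x hx hx4 y hy y' hy' hxy hxy'
    by_contra hne
    set T := ((Finset.range n).filter fun j => hasBit (row A x) j = true).image f with hT
    have hTcard : T.card = 4 := by
      rw [hT, Finset.card_image_of_injOn, ← bitCount_eq_card, hx4]
      intro i hi j hj
      simp only [Finset.coe_filter, Finset.mem_range, Set.mem_ofPred_eq] at hi hj
      exact hR.inj i hi.1 j hj.1
    have hTI : ∀ t ∈ T, t ∉ I ∧ G.Adj (f x) t := by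
      intro t ht
      obtain ⟨j, hj, rfl⟩ := Finset.mem_image.1 ht
      rw [Finset.mem_filter, Finset.mem_range] at hj
      exact ⟨hfI j hj.1, ((hR.adj x hx j).1 hj.2).2⟩
    have := hd (f x) (insert y (insert y' T)) (by
      intro t ht
      rw [Finset.mem_insert, Finset.mem_insert] at ht
      rcases ht with rfl | rfl | ht
      · exact hxy
      · exact hxy'
      · exact (hTI t ht).2)
    rw [Finset.card_insert_of_notMem, Finset.card_insert_of_notMem, hTcard] at this
    · omega
    · exact fun h => (hTI _ h).1 hy'
    · rw [Finset.mem_insert, not_or]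
      exact ⟨hne, fun h => (hTI _ h).1 hy⟩
  have hmask := fun y : V => exists_mask (fun j => G.Adj y (f j)) n
  choose M hM using hmask
  have hy : ∀ x < n, ∃ y ∈ I, G.Adj (f x) y := fun x hx => hmax (f x) (hfI x hx)
  have : Nonempty V := ⟨f 0⟩
  choose! Y hYI hY using hy
  refine ⟨fun x => M (Y x), fun x hx hx4 => ⟨?_, ?_, ?_, ?_⟩⟩
  · exact (hM _ x).2 ⟨hx, (hY x hx).symm⟩
  · refine Nat.lt_pow_two_of_testBit _ fun j hj => ?_
    rw [← hasBit_eq_testBit]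
    by_contra hb
    have := (hM (Y x) j).1 (by simpa using hb)
    omega
  · simp only [obstructs, Bool.and_eq_true, List.all_eq_true, List.mem_range]
    refine ⟨?_, ?_, ?_, ?_⟩
    · rw [Bool.not_eq_true', Bool.eq_false_iff]
      intro h0
      have := (hM (Y x) x).2 ⟨hx, (hY x hx).symm⟩
      rw [Nat.eq_of_beq_eq_true h0, hasBit_zero] at this
      exact absurd this (by simp)
    · rw [bitCount_eq_card, ← Finset.card_image_of_injOn (f := f)]
      · refine Nat.ble_eq_true_of_le (hd (Y x) _ fun t ht => ?_)
        obtain ⟨j, hj, rfl⟩ := Finset.mem_image.1 ht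
        exact ((hM (Y x) j).1 (Finset.mem_filter.1 hj).2).2
      · intro i hi j hj
        simp only [Finset.coe_filter, Finset.mem_range, Set.mem_ofPred_eq] at hi hj
        exact hR.inj i hi.1 j hj.1
    · rw [pairsOK, List.all_eq_true]
      intro d hd'
      obtain ⟨p, hp, q, hq, hpq, rfl⟩ := mem_edges hd'
      rw [hR.length_eq] at hp hq
      rw [Nat.zero_add] at hpq
      simp only [Nat.zero_add]
      cases h1 : Nat.beq (Nat.land (M (Y x)) (Nat.lor (Nat.pow 2 p) (Nat.pow 2 q))) 0
      · rfl
      · rw [cond_true, hR.land_union_eq hG (hM (Y x)) hp hq hpq (Nat.eq_of_beq_eq_true h1)]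
        exact Nat.beq_refl _
    · intro z hz
      rw [Bool.not_eq_true', Bool.eq_false_iff]
      intro hb
      simp only [Bool.and_eq_true] at hb
      obtain ⟨hb1, hb2, hb3⟩ := hb
      refine h4 (hR.colorable_four_of_avoidable hI hfI hJ hz (y := Y x) (fun w hw hzw => ?_)
        (hM (Y x)) hb3)
      exact huniq z hz (Nat.eq_of_beq_eq_true hb2) w hw (Y x) (hYI x hx) hzw
        (((hM (Y x) z).1 hb1).2).symm
  · intro z hz hz4 hb
    have : Y z = Y x := huniq z hz hz4 _ (hYI z hz) _ (hYI x hx) (hY z hz)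
      (((hM (Y x) z).1 hb).2).symm
    change M (Y z) = M (Y x)
    rw [this]

set_option maxRecDepth 10000 in
theorem obstructs_rowsA : (List.range 128).all (fun S =>
    !(obstructs 7 rowsA S && hasBit S 4)) = true := by decide +kernel

set_option maxRecDepth 10000 in
theorem obstructs_rowsB : (List.range 128).all (fun S =>
    !obstructs 7 rowsB S || (hasBit S 6 && !(hasBit S 4 && hasBit S 5))) = true := by
  decide +kernel

set_option maxRecDepth 10000 in
theorem obstructs_rowsC : ((List.range 128).filter (obstructs 7 rowsC)).all (fun S =>
    ((List.range 7).any fun x => !hasBit S x) &&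
      ((List.range 128).filter (obstructs 7 rowsC)).all fun T =>
        (List.range 7).any fun x => hasBit S x && hasBit T x) = true := by
  decide +kernel

set_option maxRecDepth 10000 in
theorem obstructs_rowsD : (List.range 256).all (fun S =>
    !(obstructs 8 rowsD S && hasBit S 4)) = true := by decide +kernel

/-- A graph of maximum degree at most five is 4-colourable if deleting a maximal independent set
leaves an exceptional graph and isolated vertices. -/
theorem TwoK2Free.colorable_four_of_isExceptional (hG : TwoK2Free G) (hd : DegreeAtMost G 5)
    {I : Set V} (hI : ∀ a ∈ I, ∀ b ∈ I, ¬ G.Adj a b) (hmax : ∀ v ∉ I, ∃ y ∈ I, G.Adj v y)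
    (hex : IsExceptional ((G.induce Iᶜ).induce (G.induce Iᶜ).support)) : G.Colorable 4 := by
  classical
  by_contra h4
  have key : ∀ {n : ℕ} {F : SimpleGraph (Fin n)} {rows : List ℕ}, 0 < n → rows.length = n →
      (∀ i j : Fin n, F.Adj i j ↔ hasBit (row rows i) j = true) →
      ((List.range n).all fun i => Nat.beq (Nat.shiftRight (row rows i) n) 0) = true →
      Nonempty ((G.induce Iᶜ).induce (G.induce Iᶜ).support ≃g F) →
      ∃ S : ℕ → ℕ, ∀ x < n, bitCount (row rows x) n = 4 → hasBit (S x) x = true ∧ S x < 2 ^ n ∧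
        obstructs n rows (S x) = true ∧
        ∀ z < n, bitCount (row rows z) n = 4 → hasBit (S x) z = true → S z = S x := by
    rintro n F rows hn hlen hF hsmall ⟨e⟩
    -- The reduction modulo n only makes `f` total.
    let f : ℕ → V := fun i => (e.symm ⟨i % n, Nat.mod_lt i hn⟩).1.1
    have hf : ∀ i (hi : i < n), f i = (e.symm ⟨i, hi⟩).1.1 := fun i hi => by
      simp only [f, Nat.mod_eq_of_lt hi]
    have hR : Realizes G f n rows := by
      refine ⟨hlen, fun i hi j hj h => ?_, fun i hi j => ?_, fun i hi => ?_⟩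
      · rw [hf i hi, hf j hj] at h
        simpa using e.symm.injective (Subtype.ext (Subtype.ext h))
      · by_cases hj : j < n
        · rw [← hF ⟨i, hi⟩ ⟨j, hj⟩, hf i hi, hf j hj, ← e.symm.map_rel_iff]
          exact (and_iff_right hj).symm
        · refine iff_of_false ?_ (by tauto)
          -- `Realizes` concerns all digits, so the rows must have none at positions from n on.
          rw [hasBit_eq_testBit, Bool.not_eq_true]
          have := List.all_eq_true.1 hsmall i (List.mem_range.2 hi)
          have h0 : row rows i >>> n = 0 := Nat.eq_of_beq_eq_true this
          apply Nat.testBit_eq_false_of_lt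
          rw [Nat.shiftRight_eq_div_pow, Nat.div_eq_zero_iff_lt (by positivity)] at h0
          exact h0.trans_le (Nat.pow_le_pow_right (by norm_num) (by omega))
      · rw [hf i hi]
        obtain ⟨w, hw⟩ := (e.symm ⟨i, hi⟩).2
        exact ⟨w.1, hw⟩
    refine hR.exists_obstruction hG hd hI hmax (fun i hi => ?_) (fun v hv hv' w hw hvw => ?_) h4
    · rw [hf i hi]
      exact (e.symm ⟨i, hi⟩).1.2
    · have hsupp : (⟨v, hv⟩ : (Iᶜ : Set V)) ∈ (G.induce Iᶜ).support := ⟨⟨w, hw⟩, hvw⟩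
      refine hv' (e ⟨⟨v, hv⟩, hsupp⟩) (Fin.is_lt _) ?_
      rw [hf _ (Fin.is_lt _)]
      exact congrArg (fun t => t.1.1) (e.symm_apply_apply ⟨⟨v, hv⟩, hsupp⟩)
  rcases hex with h | h | h | h
  · obtain ⟨S, hS⟩ := key (n := 7) (rows := rowsA) (by norm_num) rfl exceptionA_adj (by decide) h
    obtain ⟨h1, h2, h3, -⟩ := hS 4 (by norm_num) (by decide)
    have := List.all_eq_true.1 obstructs_rowsA _ (List.mem_range.2 h2)
    simp [h1, h3] at this
  · obtain ⟨S, hS⟩ := key (n := 7) (rows := rowsB) (by norm_num) rfl exceptionB_adj (by decide) h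
    obtain ⟨h1, h2, h3, h5⟩ := hS 4 (by norm_num) (by decide)
    obtain ⟨k1, k2, k3, k5⟩ := hS 5 (by norm_num) (by decide)
    have h6 := List.all_eq_true.1 obstructs_rowsB _ (List.mem_range.2 h2)
    have k6 := List.all_eq_true.1 obstructs_rowsB _ (List.mem_range.2 k2)
    -- The traces for 4 and for 5 both contain 6, so both equal the trace for 6. That trace then
    -- contains both 4 and 5, which no obstruction does.
    simp only [h1, h3, k1, k3, Bool.not_true, Bool.false_or, Bool.and_eq_true, Bool.true_and,
      Bool.and_true] at h6 k6
    have h7 := h5 6 (by norm_num) (by decide) h6.1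
    have k7 := k5 6 (by norm_num) (by decide) k6.1
    rw [← h7, k7, k1] at h6
    exact absurd h6.2 (by simp)
  · obtain ⟨S, hS⟩ := key (n := 7) (rows := rowsC) (by norm_num) rfl exceptionC_adj (by decide) h
    have hdeg : ∀ x < 7, bitCount (row rowsC x) 7 = 4 := by decide
    have hmem : ∀ x < 7, S x ∈ (List.range 128).filter (obstructs 7 rowsC) := fun x hx => by
      obtain ⟨-, h2, h3, -⟩ := hS x hx (hdeg x hx)
      exact List.mem_filter.2 ⟨List.mem_range.2 h2, h3⟩
    -- All vertices have degree 4 here, and any two obstructions meet, so all traces coincide. The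
    -- common trace would contain every vertex, but an obstruction misses some x.
    have h0 := List.all_eq_true.1 obstructs_rowsC _ (hmem 0 (by norm_num))
    simp only [Bool.and_eq_true, List.any_eq_true, List.mem_range, Bool.not_eq_true',
      List.all_eq_true] at h0
    obtain ⟨⟨x, hx, hx0⟩, hT⟩ := h0
    obtain ⟨z, hz, hz0, hzx⟩ := hT (S x) (hmem x hx)
    have h1 := (hS 0 (by norm_num) (hdeg 0 (by norm_num))).2.2.2 z hz (hdeg z hz) hz0
    have h2 := (hS x hx (hdeg x hx)).2.2.2 z hz (hdeg z hz) hzx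
    have h3 := (hS x hx (hdeg x hx)).1
    rw [← h2, h1, hx0] at h3
    exact absurd h3 (by simp)
  · obtain ⟨S, hS⟩ := key (n := 8) (rows := rowsD) (by norm_num) rfl exceptionD_adj (by decide) h
    obtain ⟨h1, h2, h3, -⟩ := hS 4 (by norm_num) (by decide)
    have := List.all_eq_true.1 obstructs_rowsD _ (List.mem_range.2 h2)
    simp [h1, h3] at this

end Extension

/-! ### Large cliques in `2K₂`-free graphs -/

section Cliques

variable {V : Type*} {G : SimpleGraph V} {q : ℕ}

theorem DegreeAtMost.card_closed_le {k : ℕ} (hd : DegreeAtMost G k) (v : V) (T : Finset V)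
    (hT : ∀ t ∈ T, t ≠ v → G.Adj v t) : T.card ≤ k + 1 := by
  classical
  have := hd v (T.erase v) fun t ht => hT t (Finset.mem_of_mem_erase ht) (Finset.ne_of_mem_erase ht)
  have := Finset.pred_card_le_card_erase (s := T) (a := v)
  omega

/-- In disjoint cliques, all vertices of one of them but one have all their neighbours in the
union. -/
theorem TwoK2Free.exists_forall_adj_mem_union [DecidableEq V] (hG : TwoK2Free G)
    (hd : DegreeAtMost G (q + 1)) (hq : 4 ≤ q) {P Q : Finset V} (hP : G.IsNClique q P)
    (hQ : G.IsNClique q Q) (hPQ : Disjoint P Q) :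
    ∃ x₁ ∈ P, ∀ x ∈ P, x ≠ x₁ → ∀ w, G.Adj x w → w ∈ P ∪ Q := by
  classical
  by_contra! h
  obtain ⟨x₀, hx₀⟩ : P.Nonempty := by
    rw [← Finset.card_pos, hP.card_eq]
    omega
  -- The vertex x₀ is arbitrary and only gives a first x; the second use gives x' ≠ x. Each of the
  -- two has at most one neighbour in Q, so at least q − 2 ≥ 2 vertices of Q miss both, and two of
  -- them form a 2K₂ with xx'.
  obtain ⟨x, hx, -, w, hxw, hw⟩ := h x₀ hx₀
  obtain ⟨x', hx', hne, w', hxw', hw'⟩ := h x hx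
  have key : ∀ x ∈ P, ∀ w, G.Adj x w → w ∉ P ∪ Q → (Q.filter fun y => G.Adj x y).card ≤ 1 := by
    intro x hx w hxw hw
    rw [Finset.mem_union, not_or] at hw
    have h1 : Disjoint P (Q.filter fun y => G.Adj x y) :=
      hPQ.mono_right (Finset.filter_subset _ _)
    have h2 : w ∉ P ∪ Q.filter fun y => G.Adj x y := by
      rw [Finset.mem_union, Finset.mem_filter]
      tauto
    have := hd.card_closed_le x (insert w (P ∪ Q.filter fun y => G.Adj x y)) (by
      intro t ht htx
      rw [Finset.mem_insert, Finset.mem_union, Finset.mem_filter] at ht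
      rcases ht with rfl | ht | ht
      · exact hxw
      · exact hP.isClique hx ht htx.symm
      · exact ht.2)
    rw [Finset.card_insert_of_notMem h2, Finset.card_union_of_disjoint h1, hP.card_eq] at this
    omega
  have h1 := key x hx w hxw hw
  have h2 := key x' hx' w' hxw' hw'
  have h3 : Q ⊆ (Q.filter fun y => G.Adj x y) ∪ (Q.filter fun y => G.Adj x' y) ∪
      Q.filter fun y => ¬ G.Adj x y ∧ ¬ G.Adj x' y := by
    intro y hy
    simp only [Finset.mem_union, Finset.mem_filter, hy, true_and]
    tauto
  have h4 := Finset.card_le_card h3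
  have h5 := Finset.card_union_le ((Q.filter fun y => G.Adj x y) ∪ (Q.filter fun y => G.Adj x' y))
    (Q.filter fun y => ¬ G.Adj x y ∧ ¬ G.Adj x' y)
  have h6 := Finset.card_union_le (Q.filter fun y => G.Adj x y) (Q.filter fun y => G.Adj x' y)
  rw [hQ.card_eq] at h4
  obtain ⟨y, hy, y', hy', hyy⟩ := Finset.one_lt_card.1
    (show 1 < (Q.filter fun y => ¬ G.Adj x y ∧ ¬ G.Adj x' y).card by omega)
  rw [Finset.mem_filter] at hy hy'
  rcases hG.adj_cross (hP.isClique hx' hx hne) (hQ.isClique hy.1 hy'.1 hyy) with h | h | h | h <;>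
    tauto

/-- Two disjoint cliques can be coloured with the vertices of one of them. -/
theorem exists_injective_not_adj [DecidableEq V]
    (hd : DegreeAtMost G (q + 1)) (hq : 4 ≤ q) {P Q : Finset V} (hP : G.IsNClique q P)
    (hQ : G.IsNClique q Q) (hPQ : Disjoint P Q) :
    ∃ φ : Q → V, Function.Injective φ ∧ ∀ y : Q, φ y ∈ P ∧ ¬ G.Adj y (φ y) := by
  classical
  have key : ∀ {P Q : Finset V}, G.IsNClique q P → Disjoint P Q → ∀ x ∈ P,
      (Q.filter fun y => G.Adj x y).card ≤ 2 := by
    intro P Q hP hPQ x hx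
    have h1 : Disjoint P (Q.filter fun y => G.Adj x y) :=
      hPQ.mono_right (Finset.filter_subset _ _)
    have := hd.card_closed_le x (P ∪ Q.filter fun y => G.Adj x y) (by
      intro t ht htx
      rw [Finset.mem_union, Finset.mem_filter] at ht
      rcases ht with ht | ht
      · exact hP.isClique hx ht htx.symm
      · exact ht.2)
    rw [Finset.card_union_of_disjoint h1, hP.card_eq] at this
    omega
  have hall := (Finset.all_card_le_biUnion_card_iff_exists_injective
    -- Hall's condition: a vertex has at most two neighbours in the other clique, so a nonempty set
    -- of at most two vertices of Q has at least q − 2 ≥ 2 candidates. For three or more, every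
    -- vertex of P is a candidate.
    (fun y : Q => P.filter fun x => ¬ G.Adj y x)).1 (by
      intro s
      rcases s.eq_empty_or_nonempty with rfl | ⟨y, hy⟩
      · simp
      have hsq : s.card ≤ q := by
        have := Finset.card_le_univ s
        rwa [Fintype.card_coe, hQ.card_eq] at this
      by_cases hs : s.card ≤ 2
      · refine le_trans ?_ (Finset.card_le_card (Finset.subset_biUnion_of_mem _ hy))
        have h1 := key hQ hPQ.symm y y.2
        have h2 := Finset.card_filter_add_card_filter_not (s := P) (fun x => G.Adj y x)
        rw [hP.card_eq] at h2
        omega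
      · refine hsq.trans (hP.card_eq ▸ Finset.card_le_card fun x hx => ?_)
        by_contra hx'
        simp only [Finset.mem_biUnion, Finset.mem_filter, hx, true_and, not_exists, not_and,
          not_not] at hx'
        have h1 := key hP hPQ x hx
        have h2 : s.map (Function.Embedding.subtype _) ⊆ Q.filter fun y => G.Adj x y := by
          intro y hy
          obtain ⟨y, hy', rfl⟩ := Finset.mem_map.1 hy
          exact Finset.mem_filter.2 ⟨y.2, (hx' y hy').symm⟩
        have h3 := Finset.card_le_card h2
        rw [Finset.card_map] at h3
        omega)
  obtain ⟨φ, hφ, h⟩ := hall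
  exact ⟨φ, hφ, fun y => Finset.mem_filter.1 (h y)⟩

/-- The vertices of P are the colours: P colours itself, and Q is matched injectively to
nonneighbours in P. The remaining vertices are independent and have neighbours in P ∪ Q only at one
x₁ in P and one y₁ in Q, so a single colour z avoiding those of x₁ and y₁ serves them all. -/
theorem TwoK2Free.colorable_of_disjoint_cliques (hG : TwoK2Free G)
    (hd : DegreeAtMost G (q + 1)) (hq : 4 ≤ q) {P Q : Finset V} (hP : G.IsNClique q P)
    (hQ : G.IsNClique q Q) (hPQ : Disjoint P Q) : G.Colorable q := by
  classical
  obtain ⟨x₁, hx₁, hx⟩ := hG.exists_forall_adj_mem_union hd hq hP hQ hPQ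
  obtain ⟨y₁, hy₁, hy⟩ := hG.exists_forall_adj_mem_union hd hq hQ hP hPQ.symm
  obtain ⟨φ, hφ, hφ'⟩ := exists_injective_not_adj hd hq hP hQ hPQ
  obtain ⟨z, hz, hz'⟩ : ∃ z ∈ P, z ∉ ({x₁, φ ⟨y₁, hy₁⟩} : Finset V) := by
    refine Finset.exists_mem_notMem_of_card_lt_card ?_
    have := Finset.card_le_two (a := x₁) (b := φ ⟨y₁, hy₁⟩)
    rw [hP.card_eq]
    omega
  simp only [Finset.mem_insert, Finset.mem_singleton, not_or] at hz'
  obtain ⟨a, b, ha, hb, hax, hbx, hab⟩ : ∃ a b, a ∈ P ∧ b ∈ P ∧ a ≠ x₁ ∧ b ≠ x₁ ∧ a ≠ b := by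
    have : 1 < (P.erase x₁).card := by
      rw [Finset.card_erase_of_mem hx₁, hP.card_eq]
      omega
    obtain ⟨a, ha, b, hb, hab⟩ := Finset.one_lt_card.1 this
    rw [Finset.mem_erase] at ha hb
    exact ⟨a, b, ha.2, hb.2, ha.1, hb.1, hab⟩
  -- The edge ab has no neighbours outside P ∪ Q, so an edge there would complete a 2K₂.
  have hR : ∀ r ∉ P ∪ Q, ∀ r' ∉ P ∪ Q, ¬ G.Adj r r' := by
    intro r hr r' hr' h
    rcases hG.adj_cross (hP.isClique ha hb hab) h with h | h | h | h
    · exact hr (hx a ha hax r h)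
    · exact hr' (hx a ha hax r' h)
    · exact hr (hx b hb hbx r h)
    · exact hr' (hx b hb hbx r' h)
  let c : V → V := fun v => if v ∈ P then v else if hv : v ∈ Q then φ ⟨v, hv⟩ else z
  have cP : ∀ v ∈ P, c v = v := fun v hv => if_pos hv
  have cQ : ∀ v (hv : v ∈ Q), c v = φ ⟨v, hv⟩ := fun v hv => by
    simp only [c]
    rw [if_neg (Finset.disjoint_right.1 hPQ hv), dif_pos hv]
  have cR : ∀ v ∉ P ∪ Q, c v = z := fun v hv => by
    rw [Finset.mem_union, not_or] at hv
    simp only [c]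
    rw [if_neg hv.1, dif_neg hv.2]
  have hc : ∀ v, c v ∈ P := by
    intro v
    by_cases hv : v ∈ P
    · rwa [cP v hv]
    · by_cases hv' : v ∈ Q
      · rw [cQ v hv']
        exact (hφ' _).1
      · rwa [cR v (by simp [hv, hv'])]
  have hPR : ∀ v ∈ P, ∀ w ∉ P ∪ Q, G.Adj v w → c v ≠ c w := by
    intro v hv w hw h
    rw [cP v hv, cR w hw]
    by_cases hvx : v = x₁
    · rw [hvx]
      exact Ne.symm hz'.1
    · exact absurd (hx v hv hvx w h) hw
  have hQR : ∀ v ∈ Q, ∀ w ∉ P ∪ Q, G.Adj v w → c v ≠ c w := by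
    intro v hv w hw h
    rw [cQ v hv, cR w hw]
    by_cases hvy : v = y₁
    · subst hvy
      exact Ne.symm hz'.2
    · exact absurd (Finset.union_comm Q P ▸ hy v hv hvy w h) hw
  have hQP : ∀ v ∈ Q, ∀ w ∈ P, G.Adj v w → c v ≠ c w := by
    intro v hv w hw h
    rw [cQ v hv, cP w hw]
    rintro rfl
    exact (hφ' ⟨v, hv⟩).2 h
  have hcol : ∀ v w, G.Adj v w → c v ≠ c w := by
    intro v w h
    by_cases hv : v ∈ P <;> by_cases hw : w ∈ P
    · rw [cP v hv, cP w hw]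
      exact h.ne
    · by_cases hw' : w ∈ Q
      · exact (hQP w hw' v hv h.symm).symm
      · exact hPR v hv w (by simp [hw, hw']) h
    · by_cases hv' : v ∈ Q
      · exact hQP v hv' w hw h
      · exact (hPR w hw v (by simp [hv, hv']) h.symm).symm
    · by_cases hv' : v ∈ Q <;> by_cases hw' : w ∈ Q
      · rw [cQ v hv', cQ w hw']
        exact fun he => h.ne (congrArg Subtype.val (hφ he))
      · exact hQR v hv' w (by simp [hw, hw']) h
      · exact (hQR w hw' v (by simp [hv, hv']) h.symm).symm
      · exact absurd h (hR v (by simp [hv, hv']) w (by simp [hw, hw']))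
  have := (SimpleGraph.Coloring.mk (G := G) (fun v => (⟨c v, hc v⟩ : P))
    fun {v w} h he => hcol v w h (congrArg Subtype.val he)).colorable
  rwa [Fintype.card_coe, hP.card_eq] at this

/-- Pairwise intersecting cliques of order one less than the degree bound have a common vertex. -/
theorem exists_mem_of_intersecting_cliques (hd : DegreeAtMost G (q + 1)) (hq : 4 ≤ q)
    (hf : G.CliqueFree (q + 1))
    (hint : ∀ P Q : Finset V, G.IsNClique q P → G.IsNClique q Q → ¬ Disjoint P Q)
    {P : Finset V} (hP : G.IsNClique q P) :
    ∃ v, ∀ Q : Finset V, G.IsNClique q Q → v ∈ Q := by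
  classical
  -- A common vertex is adjacent to all the rest of P ∪ Q, which therefore has at most q + 2
  -- elements.
  have hcard : ∀ P Q : Finset V, G.IsNClique q P → G.IsNClique q Q → (P \ Q).card ≤ 2 := by
    intro P Q hP hQ
    obtain ⟨v, hvP, hvQ⟩ := Finset.not_disjoint_iff.1 (hint P Q hP hQ)
    have := hd.card_closed_le v (P ∪ Q) (by
      intro t ht htv
      rcases Finset.mem_union.1 ht with ht | ht
      · exact hP.isClique hvP ht htv.symm
      · exact hQ.isClique hvQ ht htv.symm)
    rw [← Finset.sdiff_union_self_eq_union, Finset.card_union_of_disjoint Finset.sdiff_disjoint,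
      hQ.card_eq] at this
    omega
  have hno : ∀ Q : Finset V, G.IsNClique q Q → ∀ v ∉ Q, ∃ w ∈ Q, ¬ G.Adj v w := by
    intro Q hQ v hv
    by_contra! h
    exact hf _ (hQ.insert h)
  by_cases h2 : ∃ P Q : Finset V, G.IsNClique q P ∧ G.IsNClique q Q ∧ 2 ≤ (P \ Q).card
  · obtain ⟨P, Q, hP, hQ, hPQ⟩ := h2
    have hPQ2 : (P \ Q).card = 2 := le_antisymm (hcard P Q hP hQ) hPQ
    have hi := Finset.card_sdiff_add_card_inter P Q
    have hj := Finset.card_sdiff_add_card_inter Q P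
    rw [Finset.inter_comm, hQ.card_eq] at hj
    rw [hP.card_eq] at hi
    have hU : (P ∪ Q).card = q + 2 := by
      rw [← Finset.sdiff_union_self_eq_union, Finset.card_union_of_disjoint Finset.sdiff_disjoint,
        hQ.card_eq, hPQ2]
      omega
    have hadj : ∀ p ∈ P ∩ Q, ∀ t ∈ P ∪ Q, t ≠ p → G.Adj p t := by
      intro p hp t ht htp
      rw [Finset.mem_inter] at hp
      rcases Finset.mem_union.1 ht with ht | ht
      · exact hP.isClique hp.1 ht htp.symm
      · exact hQ.isClique hp.2 ht htp.symm
    -- Here |P ∪ Q| = q + 2, so the closed neighbourhood of p is exactly P ∪ Q.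
    have hsat : ∀ p ∈ P ∩ Q, ∀ t, G.Adj p t → t ∈ P ∪ Q := by
      intro p hp t hpt
      by_contra ht
      have := hd.card_closed_le p (insert t (P ∪ Q)) (by
        intro s hs hsp
        rcases Finset.mem_insert.1 hs with rfl | hs
        · exact hpt
        · exact hadj p hp s hs hsp)
      rw [Finset.card_insert_of_notMem ht] at this
      omega
    obtain ⟨p, hp⟩ : (P ∩ Q).Nonempty := by
      rw [← Finset.card_pos]
      omega
    refine ⟨p, fun R hR => ?_⟩
    by_contra hpR
    -- If R contained p', it would lie in P ∪ Q, and p could be added to it.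
    have hdisj : ∀ p' ∈ P ∩ Q, p' ∉ R := by
      intro p' hp' hp'R
      obtain ⟨w, hw, hpw⟩ := hno R hR p hpR
      refine hpw (hadj p hp w ?_ (by rintro rfl; exact hpR hw))
      by_cases hwp : w = p'
      · rw [hwp]
        exact Finset.mem_union_left _ (Finset.mem_inter.1 hp').1
      · exact hsat p' hp' w (hR.isClique hp'R hw (Ne.symm hwp))
    -- S ∩ R has at least q − 2 ≥ 2 elements and lies in the two-element set S \ T, hence equals it.
    -- Thus R contains both P \ Q and Q \ P, and a vertex of Q \ P is adjacent to all of P, against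
    -- ω ≤ q.
    have hsub : ∀ S T : Finset V, G.IsNClique q S → (S \ T).card = 2 → (∀ p ∈ S ∩ T, p ∉ R) →
        S \ T ⊆ R := by
      intro S T hS hST hdis
      have h1 := Finset.card_sdiff_add_card_inter S R
      have h2 := hcard S R hS hR
      rw [hS.card_eq] at h1
      have h3 : S ∩ R ⊆ S \ T := by
        intro x hx
        rw [Finset.mem_inter] at hx
        rw [Finset.mem_sdiff]
        exact ⟨hx.1, fun hxT => hdis x (Finset.mem_inter.2 ⟨hx.1, hxT⟩) hx.2⟩
      have h4 := Finset.eq_of_subset_of_card_le h3 (by omega)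
      rw [← h4]
      exact Finset.inter_subset_right
    have hPR := hsub P Q hP hPQ2 hdisj
    have hQR := hsub Q P hQ (by omega) (by rwa [Finset.inter_comm])
    obtain ⟨y, hy⟩ : (Q \ P).Nonempty := by
      rw [← Finset.card_pos]
      omega
    obtain ⟨w, hw, hyw⟩ := hno P hP y (Finset.mem_sdiff.1 hy).2
    have hne : y ≠ w := by
      rintro rfl
      exact (Finset.mem_sdiff.1 hy).2 hw
    by_cases hwQ : w ∈ Q
    · exact hyw (hQ.isClique (Finset.mem_sdiff.1 hy).1 hwQ hne)
    · exact hyw (hR.isClique (hQR hy) (hPR (Finset.mem_sdiff.2 ⟨hw, hwQ⟩)) hne)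
  · push Not at h2
    by_contra! hno'
    -- Any two q-cliques now differ in at most one vertex. A clique missing p supplies a vertex
    -- outside P adjacent to exactly P − p.
    have hy : ∀ p ∈ P, ∃ y ∉ P, (∀ x ∈ P, x ≠ p → G.Adj y x) ∧ ¬ G.Adj y p := by
      intro p hp
      obtain ⟨Q, hQ, hpQ⟩ := hno' p
      have h1 : P \ Q = {p} := by
        refine (Finset.eq_of_subset_of_card_le (Finset.singleton_subset_iff.2
          (Finset.mem_sdiff.2 ⟨hp, hpQ⟩)) ?_).symm
        have := h2 P Q hP hQ
        rw [Finset.card_singleton]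
        omega
      obtain ⟨y, hyQ, hyP⟩ : ∃ y ∈ Q, y ∉ P := by
        by_contra! h
        have := Finset.eq_of_subset_of_card_le h (by rw [hP.card_eq, hQ.card_eq])
        exact hpQ (this ▸ hp)
      have h3 : ∀ x ∈ P, x ≠ p → G.Adj y x := by
        intro x hx hxp
        have hxQ : x ∈ Q := by
          by_contra hxQ
          have : x ∈ P \ Q := Finset.mem_sdiff.2 ⟨hx, hxQ⟩
          rw [h1, Finset.mem_singleton] at this
          exact hxp this
        exact hQ.isClique hyQ hxQ (by rintro rfl; exact hyP hx)
      refine ⟨y, hyP, h3, fun h => ?_⟩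
      obtain ⟨w, hw, hyw⟩ := hno P hP y hyP
      by_cases hwp : w = p
      · exact hyw (hwp ▸ h)
      · exact hyw (h3 w hw hwp)
    choose! y hyP hyadj hynadj using hy
    obtain ⟨p, hp⟩ : P.Nonempty := by
      rw [← Finset.card_pos, hP.card_eq]
      omega
    have hinj : Set.InjOn y (P.erase p) := by
      intro a ha b hb hab
      rw [Finset.mem_coe, Finset.mem_erase] at ha hb
      by_contra hne
      exact hynadj b hb.2 (hab ▸ hyadj a ha.2 b hb.2 (Ne.symm hne))
    have hdis : Disjoint P ((P.erase p).image y) := by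
      rw [Finset.disjoint_right]
      intro t ht
      obtain ⟨a, ha, rfl⟩ := Finset.mem_image.1 ht
      exact hyP a (Finset.mem_of_mem_erase ha)
    -- The closed neighbourhood of p contains P and the q − 1 distinct vertices belonging to the
    -- other members of P, and 2q − 1 > q + 2 for q ≥ 4.
    have := hd.card_closed_le p (P ∪ (P.erase p).image y) (by
      intro t ht htp
      rcases Finset.mem_union.1 ht with ht | ht
      · exact hP.isClique hp ht htp.symm
      · obtain ⟨a, ha, rfl⟩ := Finset.mem_image.1 ht
        exact (hyadj a (Finset.mem_of_mem_erase ha) p hp (Finset.ne_of_mem_erase ha).symm).symm)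
    rw [Finset.card_union_of_disjoint hdis, Finset.card_image_of_injOn hinj,
      Finset.card_erase_of_mem hp, hP.card_eq] at this
    omega

/-- There is a `q`-colouring or an independent set of at most one vertex that meets all cliques
of order `q`. -/
theorem TwoK2Free.colorable_or_exists_transversal (hG : TwoK2Free G)
    (hd : DegreeAtMost G (q + 1)) (hq : 4 ≤ q) (hf : G.CliqueFree (q + 1)) :
    G.Colorable q ∨ ∃ J : Set V, J.Subsingleton ∧
      ∀ Q : Finset V, G.IsNClique q Q → ∃ v ∈ Q, v ∈ J := by
  by_cases h1 : ∃ P Q : Finset V, G.IsNClique q P ∧ G.IsNClique q Q ∧ Disjoint P Q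
  · obtain ⟨P, Q, hP, hQ, hPQ⟩ := h1
    exact .inl (hG.colorable_of_disjoint_cliques hd hq hP hQ hPQ)
  · push Not at h1
    right
    by_cases h2 : ∃ P : Finset V, G.IsNClique q P
    · obtain ⟨P, hP⟩ := h2
      obtain ⟨v, hv⟩ := exists_mem_of_intersecting_cliques hd hq hf h1 hP
      exact ⟨{v}, Set.subsingleton_singleton, fun Q hQ => ⟨v, hv Q hQ, rfl⟩⟩
    · exact ⟨∅, Set.subsingleton_empty, fun Q hQ => absurd ⟨Q, hQ⟩ h2⟩

end Cliques

/-! ### The main theorem -/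

universe u

/-- The colouring bound for maximum degree at most `q + 1` and clique number at most `q`,
for `q ≥ 4`. -/
theorem TwoK2Free.colorable_of_degreeAtMost_succ {q : ℕ} (hq : 4 ≤ q) :
    ∀ {V : Type u} [Finite V] {G : SimpleGraph V}, TwoK2Free G → DegreeAtMost G (q + 1) →
      G.CliqueFree (q + 1) → G.Colorable q := by
  have key : ∀ {q : ℕ}, 4 ≤ q → ∀ {V : Type u} [Finite V] {G : SimpleGraph V}, TwoK2Free G →
      DegreeAtMost G (q + 1) → G.CliqueFree (q + 1) → G.Colorable q ∨ ∃ I : Set V,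
        (∀ a ∈ I, ∀ b ∈ I, ¬ G.Adj a b) ∧ (∀ v ∉ I, ∃ y ∈ I, G.Adj v y) ∧
        (G.induce Iᶜ).CliqueFree q := by
    intro q hq V _ G hG hd hf
    refine (hG.colorable_or_exists_transversal hd hq hf).imp_right ?_
    rintro ⟨J, hJ, hJQ⟩
    -- Maximality of I lowers the degree bound of the rest, and J ⊆ I destroys all q-cliques.
    obtain ⟨I, hJI, hI, hmax⟩ := exists_maximal_independent (G := G) J fun a ha b hb h =>
      h.ne (hJ ha hb)
    refine ⟨I, hI, hmax, fun t ht => ?_⟩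
    obtain ⟨v, hv, hvJ⟩ := hJQ _ ((SimpleGraph.isNClique_induce_iff _ _ _).1 ht)
    obtain ⟨w, -, rfl⟩ := Finset.mem_map.1 hv
    exact w.2 (hJI hvJ)
  induction q, hq using Nat.le_induction with
  | base =>
    intro V _ G hG hd hf
    rcases key le_rfl hG hd hf with h | ⟨I, hI, hmax, hIf⟩
    · exact h
    · rcases (hG.induce Iᶜ).colorable_three_or_isExceptional (hd.induce_compl hmax) hIf with h | h
      · exact colorable_succ_of_induce_compl hI h
      · exact hG.colorable_four_of_isExceptional hd hI hmax h
  | succ q hq ih =>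
    intro V _ G hG hd hf
    rcases key (by omega) hG hd hf with h | ⟨I, hI, hmax, hIf⟩
    · exact h
    · exact colorable_succ_of_induce_compl hI (ih (hG.induce Iᶜ) (hd.induce_compl hmax) hIf)

/-- This forces Δ = 4, rather than Δ ≤ 4, in the second exception. -/
theorem IsExceptional.not_degreeAtMost_three {V : Type*} {G : SimpleGraph V}
    (h : IsExceptional (G.induce G.support)) : ¬ DegreeAtMost G 3 := by
  have key : ∀ {n : ℕ} {F : SimpleGraph (Fin n)} (i : Fin n) (T : Finset (Fin n)), T.card = 4 →
      (∀ j ∈ T, F.Adj i j) → Nonempty (G.induce G.support ≃g F) → ¬ DegreeAtMost G 3 := by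
    rintro n F i T hT hadj ⟨e⟩ hd
    have := hd (e.symm i).1 (T.map (e.symm.toEquiv.toEmbedding.trans
      (Function.Embedding.subtype _))) (by
        intro t ht
        obtain ⟨j, hj, rfl⟩ := Finset.mem_map.1 ht
        exact e.symm.map_rel_iff.2 (hadj j hj))
    rw [Finset.card_map] at this
    omega
  rcases h with h | h | h | h
  · exact key 4 {1, 2, 5, 6} rfl (by simp only [exceptionA_adj]; decide) h
  · exact key 4 {1, 2, 5, 6} rfl (by simp only [exceptionB_adj]; decide) h
  · exact key 0 {2, 3, 4, 5} rfl (by simp only [exceptionC_adj]; decide) h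
  · exact key 4 {1, 2, 5, 6} rfl (by simp only [exceptionD_adj]; decide) h

/-- In the second exception, `G.induce G.support` is `G` with its isolated vertices deleted
(it is `G` itself when `G` is connected). -/
theorem mainTheorem3 {V : Type*} [Fintype V] (G : SimpleGraph V) [DecidableRel G.Adj]
    (hG : TwoK2Free G) :
    G.chromaticNumber ≤ ((max G.cliqueNum (G.maxDegree - 1) : ℕ) : ℕ∞) ∨
    (G.maxDegree ≤ 3 ∧ G.cliqueNum = 2 ∧ G.chromaticNumber = 3 ∧ HasInducedOddCycle G) ∨
    (G.maxDegree = 4 ∧ G.chromaticNumber = 4 ∧ G.cliqueNum = 3 ∧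
      IsExceptional (G.induce G.support)) := by
  classical
  have hdeg : ∀ k, G.maxDegree ≤ k → DegreeAtMost G k := fun k hk =>
    degreeAtMost_maxDegree.mono hk
  have hfree : ∀ k, G.cliqueNum < k → G.CliqueFree k := by
    intro k hk t ht
    have := ht.isClique.card_le_cliqueNum
    rw [ht.card_eq] at this
    omega
  have hchrom : ∀ k : ℕ, G.Colorable (k + 1) → ¬ G.Colorable k →
      G.chromaticNumber = ((k + 1 : ℕ) : ℕ∞) := by
    intro k h1 h2
    refine le_antisymm (SimpleGraph.chromaticNumber_le_iff_colorable.2 h1) ?_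
    by_contra! h
    rw [Nat.cast_add, Nat.cast_one, ENat.lt_add_one_iff (ENat.natCast_ne_top k)] at h
    exact h2 (SimpleGraph.chromaticNumber_le_iff_colorable.1 h)
  rw [SimpleGraph.chromaticNumber_le_iff_colorable]
  by_cases h0 : G.Colorable (max G.cliqueNum (G.maxDegree - 1))
  · exact .inl h0
  right
  set M := max G.cliqueNum (G.maxDegree - 1) with hM
  have hwM : G.cliqueNum ≤ M := le_max_left _ _
  have hDM : G.maxDegree ≤ M + 1 := by
    have : G.maxDegree - 1 ≤ M := le_max_right _ _
    omega
  have hM3 : M ≤ 3 := by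
    by_contra! h
    exact h0 (hG.colorable_of_degreeAtMost_succ h (hdeg _ hDM) (hfree _ (by omega)))
  by_cases h3 : G.Colorable 3
  · left
    -- With M = 3, a 3-colouring would already satisfy the bound.
    have hM2 : M ≤ 2 := by
      by_contra! h
      exact h0 (h3.mono h)
    have hedge : ∃ u v, G.Adj u v := by
      by_contra! h
      refine h0 ?_
      rcases isEmpty_or_nonempty V with hV | ⟨⟨v⟩⟩
      · exact SimpleGraph.Colorable.of_isEmpty _
      · have h1 : G.Colorable 1 := ⟨SimpleGraph.Coloring.mk (fun _ => 0) fun h' => absurd h' (h _ _)⟩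
        have h2 : G.IsClique (({v} : Finset V) : Set V) := by simp
        exact h1.mono (h2.card_le_cliqueNum.trans hwM)
    obtain ⟨u, v, huv⟩ := hedge
    have hw : 2 ≤ G.cliqueNum := by
      have h2 : G.IsClique (({u, v} : Finset V) : Set V) := by
        simp [huv]
      have := h2.card_le_cliqueNum
      rwa [Finset.card_pair huv.ne] at this
    have h2 : ¬ G.Colorable 2 := fun h => h0 (h.mono (hw.trans hwM))
    refine ⟨by omega, by omega, hchrom 2 h3 h2, 5, by norm_num, by decide, ?_⟩
    by_contra h5
    exact h2 (hG.colorable_two (hfree 3 (by omega)) h5)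
  · right
    have hex := (hG.colorable_three_or_isExceptional (hdeg 4 (by omega))
      (hfree 4 (by omega))).resolve_left h3
    have h4 : G.Colorable 4 := hG.colorable_of_degreeAtMost_succ le_rfl (hdeg _ (by omega))
      (hfree _ (by omega))
    refine ⟨?_, hchrom 3 h4 h3, ?_, hex⟩
    · by_contra hD
      exact hex.not_degreeAtMost_three (hdeg 3 (by omega))
    -- If ω ≤ 2, the graph would be triangle-free and so 3-colourable.
    · by_contra hw
      exact h3 (hG.colorable_three_of_cliqueFree_three (hfree 3 (by omega)))
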